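/- Let $M$ be a smooth manifold of dimension $2m+1$ without boundary, and let $\xi_0$ be a cooriented contact structure on $M$: $\xi_0=\ker\alpha$ for a smooth $1$-form $\alpha$ with $\alpha\wedge(d\alpha)^m$ nowhere zero, where $\alpha$ is determined up to multiplication by a positive function. Let $\mathcal C(M,\xi_0)$ be the space of cooriented contact structures on $M$ that are isotopic to $\xi_0$ (carried to it, with coorientation, by the time-one map of a smooth isotopy of $M$ starting at the identity), with the $C^\infty$ topology (convergence of all derivatives, uniformly on compact sets). For $z=(e_0,e_1,e_2)\in S^2\subset\mathbb R^3$ let $L_z$ be the left multiplication by the imaginary quaternion $e_0i+e_1j+e_2k$ on $\mathbb H^{n+1}=\mathbb H\oplus\mathbb H^n$. Regard $\mathbb R^{4n+3}$ as $\operatorname{Im}\mathbb H\oplus\mathbb H^n$, the orthogonal complement of $\partial_r=(1,0)$ in $\mathbb H^{n+1}$. The linear quaternionic sphere assigns to $z$ the pair $(\eta_z,L_z|_{\eta_z})$, where $\eta_z\subset\mathbb R^{4n+3}$ is the hyperplane orthogonal to $L_z\partial_r$, cooriented by $L_z\partial_r$; it is $L_z$-invariant. A smooth map $\xi:S^2\to\mathcal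 C(M,\xi_0)$ is an almost-quaternionic sphere if 1. there is a family $(\mathfrak j_z)_{z\in S^2}$, continuous in $z$, of smooth almost complex structures $\mathfrak j_z$ on the hyperplane fields $\xi(z)=\ker\alpha_z$ that are compatible with $d\alpha_z|_{\xi(z)}$, i.e. $d\alpha_z(\mathfrak j_zu,\mathfrak j_zv)=d\alpha_z(u,v)$ and $d\alpha_z(u,\mathfrak j_zu)>0$ for $u\ne0$; and 2. there are an $n\ge 0$, a point $q\in M$ and a linear isomorphism $\tau:T_qM\to\mathbb R^{4n+3}$ such that for every $z\in S^2$ the map $\tau$ carries $(\xi(z)_q,\mathfrak j_{z,q})$, with its coorientation, to $(\eta_z,L_z|_{\eta_z})$. Then the class of every almost-quaternionic sphere $\xi$ in $\pi_2(\mathcal C(M,\xi_0),\xi(N))$, where $N\in S^2$ is the north pole, has infinite order. -/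

import Mathlib

open scoped Manifold ContDiff Topology unitInterval Quaternion UniformConvergence EuclideanSpace
open Bundle Metric

noncomputable section

namespace ContactSpheres

/-! ### Contact forms -/

/-- The model space `ℝ^{2m+1}`. -/
abbrev Model (m : ℕ) : Type := EuclideanSpace ℝ (Fin (2 * m + 1))

/-- The value of `a ∧ Ω^m` on `2m+1` vectors, for a linear form `a` and a bilinear form `Ω`
(up to a positive factor depending only on `m`): the full antisymmetrization of
`a ⊗ Ω ⊗ ⋯ ⊗ Ω`. -/
def wedgePow {V : Type*} (m : ℕ) (a : V → ℝ) (Ω : V → V → ℝ) (v : Fin (2 * m + 1) → V) : ℝ :=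
  ∑ s : Equiv.Perm (Fin (2 * m + 1)), ((Equiv.Perm.sign s : ℤ) : ℝ) *
    (a (v (s ⟨0, by omega⟩)) *
      ∏ i : Fin m, Ω (v (s ⟨2 * i + 1, by omega⟩)) (v (s ⟨2 * i + 2, by omega⟩)))

section Forms

variable {m : ℕ} {M : Type*} [TopologicalSpace M] [ChartedSpace (Model m) M]

/-- The coordinate expression of a 1-form in the preferred chart at `p`, that is, its pullback
under the inverse of that chart. It is meaningful on the target of the chart. -/
def localForm (α : ∀ x : M, TangentSpace (𝓡 (2 * m + 1)) x →L[ℝ] ℝ) (p : M) (y : Model m) :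
    Model m →L[ℝ] ℝ :=
  (α ((extChartAt (𝓡 (2 * m + 1)) p).symm y)).comp
    (mfderiv 𝓘(ℝ, Model m) (𝓡 (2 * m + 1)) (extChartAt (𝓡 (2 * m + 1)) p).symm y)

/-- The exterior derivative of a 1-form at `x`, computed in the preferred chart at `x`:
`dα(u, v) = D_u α (v) - D_v α (u)`. -/
def dForm (α : ∀ x : M, TangentSpace (𝓡 (2 * m + 1)) x →L[ℝ] ℝ) (x : M)
    (u v : TangentSpace (𝓡 (2 * m + 1)) x) : ℝ :=
  let φ := extChartAt (𝓡 (2 * m + 1)) x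
  let D := mfderiv (𝓡 (2 * m + 1)) 𝓘(ℝ, Model m) φ x
  fderiv ℝ (localForm α x) (φ x) (D u) (D v) - fderiv ℝ (localForm α x) (φ x) (D v) (D u)

end Forms

/-- A smooth contact form on a `(2m+1)`-manifold: `α ∧ (dα)^m` vanishes nowhere. -/
structure ContactForm (m : ℕ) (M : Type*) [TopologicalSpace M] [ChartedSpace (Model m) M]
    [IsManifold (𝓡 (2 * m + 1)) ∞ M] where
  toFun : ∀ x : M, TangentSpace (𝓡 (2 * m + 1)) x →L[ℝ] ℝ
  smooth : ContMDiff (𝓡 (2 * m + 1)) ((𝓡 (2 * m + 1)).prod 𝓘(ℝ, Model m →L[ℝ] ℝ)) ∞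
    (fun x : M => TotalSpace.mk' (Model m →L[ℝ] ℝ)
      (E := fun x : M => TangentSpace (𝓡 (2 * m + 1)) x →L[ℝ] ℝ) x (toFun x))
  contact : ∀ x, ∃ v : Fin (2 * m + 1) → TangentSpace (𝓡 (2 * m + 1)) x,
    wedgePow m (toFun x) (dForm toFun x) v ≠ 0

variable {m : ℕ} {M : Type*} [TopologicalSpace M] [ChartedSpace (Model m) M]
  [IsManifold (𝓡 (2 * m + 1)) ∞ M]

/-- The `C^∞` topology on contact forms: uniform convergence of the partial derivatives of all
orders of the coordinate expressions, on compact subsets of the chart domains. -/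
instance : TopologicalSpace (ContactForm m M) :=
  ⨅ (p : M) (k : ℕ), TopologicalSpace.induced
    (fun α : ContactForm m M => UniformOnFun.ofFun
      {K : Set (Model m) | IsCompact K ∧ K ⊆ (extChartAt (𝓡 (2 * m + 1)) p).target}
      (iteratedFDeriv ℝ k (localForm α.toFun p))) inferInstance

/-! ### Cooriented contact structures -/

/-- Two contact forms define the same cooriented hyperplane field when they are pointwise positive
multiples of each other (the factor is then automatically a smooth function). -/
instance ContactForm.setoid (m : ℕ) (M : Type*) [TopologicalSpace M] [ChartedSpace (Model m) M]
    [IsManifold (𝓡 (2 * m + 1)) ∞ M] : Setoid (ContactForm m M) where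
  r α β := ∀ x, ∃ c : ℝ, 0 < c ∧ β.toFun x = c • α.toFun x
  iseqv :=
    { refl := fun α x => ⟨1, one_pos, by simp⟩
      symm := fun {α β} h x => by
        obtain ⟨c, hc, e⟩ := h x
        exact ⟨c⁻¹, inv_pos.2 hc, by rw [e, smul_smul, inv_mul_cancel₀ hc.ne', one_smul]⟩
      trans := fun {α β γ} h h' x => by
        obtain ⟨c, hc, e⟩ := h x
        obtain ⟨c', hc', e'⟩ := h' x
        exact ⟨c' * c, mul_pos hc' hc, by rw [e', e, smul_smul]⟩ }

/-- Cooriented contact structures `ξ = ker α`, i.e. contact forms up to positive functions. -/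
def ContactStructure (m : ℕ) (M : Type*) [TopologicalSpace M] [ChartedSpace (Model m) M]
    [IsManifold (𝓡 (2 * m + 1)) ∞ M] : Type _ :=
  Quotient (ContactForm.setoid m M)

/-- The `C^∞` topology on cooriented contact structures. -/
instance : TopologicalSpace (ContactStructure m M) :=
  inferInstanceAs (TopologicalSpace (Quotient (ContactForm.setoid m M)))

/-- The cooriented contact structure `ker α`. -/
def ContactForm.ker (α : ContactForm m M) : ContactStructure m M :=
  Quotient.mk (ContactForm.setoid m M) α

/-- `ξ` is isotopic to `ξ₀`: there is a smooth isotopy `φ_t` of `M` with `φ_0 = id` such that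
`φ_1` carries `ξ₀` to `ξ`, coorientations included, i.e. `φ_1^* β` is a positive multiple of `α`
where `ξ₀ = ker α` and `ξ = ker β`. -/
def Isotopic (ξ₀ ξ : ContactStructure m M) : Prop :=
  ∃ φ : ℝ → Diffeomorph (𝓡 (2 * m + 1)) (𝓡 (2 * m + 1)) M M ∞,
    ContMDiff (𝓘(ℝ, ℝ).prod (𝓡 (2 * m + 1))) (𝓡 (2 * m + 1)) ∞
      (fun p : ℝ × M => φ p.1 p.2) ∧
    (∀ x, φ 0 x = x) ∧
    ∃ α β : ContactForm m M, α.ker = ξ₀ ∧ β.ker = ξ ∧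
      ∀ x, ∃ c : ℝ, 0 < c ∧
        (β.toFun (φ 1 x)).comp (mfderiv (𝓡 (2 * m + 1)) (𝓡 (2 * m + 1)) (φ 1) x) =
          c • α.toFun x

/-- The space `𝒞(M, ξ₀)` of contact structures isotopic to `ξ₀`, with the `C^∞` topology. -/
abbrev ContactSpace (ξ₀ : ContactStructure m M) : Type _ :=
  {ξ : ContactStructure m M // Isotopic ξ₀ ξ}

/-! ### Contact spheres and their homotopy classes -/

/-- The standard 2-sphere in `ℝ³`. -/
abbrev S2 : Type := sphere (0 : EuclideanSpace ℝ (Fin 3)) 1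

/-- A contact sphere: a smooth map `S² → 𝒞(M, ξ₀)`. Smoothness means that the structures are the
kernels of a family of forms that is smooth in both variables. -/
structure ContactSphere (ξ₀ : ContactStructure m M) where
  toMap : C(S2, ContactSpace ξ₀)
  smooth : ∃ A : S2 → ContactForm m M, (∀ z, (A z).ker = (toMap z).1) ∧
    ContMDiff ((𝓡 2).prod (𝓡 (2 * m + 1))) ((𝓡 (2 * m + 1)).prod 𝓘(ℝ, Model m →L[ℝ] ℝ)) ∞
      (fun p : S2 × M => TotalSpace.mk' (Model m →L[ℝ] ℝ)
        (E := fun x : M => TangentSpace (𝓡 (2 * m + 1)) x →L[ℝ] ℝ) p.2 ((A p.1).toFun p.2))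

/-- The point of `S²` with stereographic coordinates `(x/w, y/w)`, projecting from the north pole;
it is the north pole itself when `w = 0`. -/
def collapseVec (x y w : ℝ) : EuclideanSpace ℝ (Fin 3) :=
  !₂[2 * x * w / (x ^ 2 + y ^ 2 + w ^ 2), 2 * y * w / (x ^ 2 + y ^ 2 + w ^ 2),
    (x ^ 2 + y ^ 2 - w ^ 2) / (x ^ 2 + y ^ 2 + w ^ 2)]

theorem collapseVec_mem {x y w : ℝ} (h : x ^ 2 + y ^ 2 + w ^ 2 ≠ 0) :
    collapseVec x y w ∈ sphere (0 : EuclideanSpace ℝ (Fin 3)) 1 := by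
  rw [mem_sphere_zero_iff_norm, EuclideanSpace.norm_eq, Real.sqrt_eq_one, Fin.sum_univ_three]
  simp only [collapseVec, Real.norm_eq_abs, sq_abs]
  simp
  field_simp
  ring

theorem collapse_ne (x y : ℝ) : x ^ 2 + y ^ 2 + ((1 - x ^ 2) * (1 - y ^ 2)) ^ 2 ≠ 0 := by
  intro h
  have hx : x ^ 2 = 0 := by nlinarith [sq_nonneg x, sq_nonneg y, sq_nonneg ((1 - x^2) * (1 - y^2))]
  have hy : y ^ 2 = 0 := by nlinarith [sq_nonneg x, sq_nonneg y, sq_nonneg ((1 - x^2) * (1 - y^2))]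
  rw [hx, hy] at h
  norm_num at h

/-- The collapse `I² → I²/∂I² ≅ S²`: with `x = 2t₀ - 1`, `y = 2t₁ - 1`, it maps the open square
homeomorphically onto the sphere minus the north pole, through the stereographic coordinates
`(x, y) / ((1 - x²)(1 - y²))`, and the boundary of the square to the north pole. -/
def collapse : C(Fin 2 → I, S2) where
  toFun t := ⟨collapseVec (2 * t 0 - 1) (2 * t 1 - 1)
    ((1 - (2 * (t 0 : ℝ) - 1) ^ 2) * (1 - (2 * (t 1 : ℝ) - 1) ^ 2)),
    collapseVec_mem (collapse_ne _ _)⟩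
  continuous_toFun := by
    refine Continuous.subtype_mk ?_ _
    refine (PiLp.continuous_toLp 2 _).comp (continuous_pi fun i => ?_)
    have h := fun t : Fin 2 → I => collapse_ne (2 * (t 0 : ℝ) - 1) (2 * (t 1 : ℝ) - 1)
    fin_cases i <;> exact Continuous.div (by fun_prop) (by fun_prop) h

/-- The north pole `(0, 0, 1)`. -/
def northPole : S2 := ⟨collapseVec 1 0 0, collapseVec_mem (by norm_num)⟩

theorem collapse_boundary (t : Fin 2 → I) (ht : t ∈ Cube.boundary (Fin 2)) :
    collapse t = northPole := by
  have hw : (1 - (2 * (t 0 : ℝ) - 1) ^ 2) * (1 - (2 * (t 1 : ℝ) - 1) ^ 2) = 0 := by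
    obtain ⟨i, hi⟩ := ht
    fin_cases i <;> rcases hi with hi | hi <;> simp at hi <;> rw [hi] <;> norm_num
  have hne := collapse_ne (2 * (t 0 : ℝ) - 1) (2 * (t 1 : ℝ) - 1)
  apply Subtype.ext
  simp only [collapse, ContinuousMap.coe_mk, northPole, collapseVec]
  rw [hw] at hne ⊢
  simp only [ne_eq, OfNat.ofNat_ne_zero, not_false_eq_true, zero_pow, add_zero, sub_zero] at hne ⊢
  rw [div_self hne]
  norm_num

/-- The class in `π₂(X, f(N))` of a map `f : S² → X`, where `N` is the north pole. -/
def sphereClass {X : Type*} [TopologicalSpace X] (f : C(S2, X)) :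
    HomotopyGroup.Pi 2 X (f northPole) :=
  Quotient.mk (GenLoop.Homotopic.setoid (Fin 2) (f northPole))
    ⟨f.comp collapse, fun t ht => congrArg f (collapse_boundary t ht)⟩

/-! ### Almost complex structures and the linear quaternionic sphere -/

/-- `j` restricts to an almost complex structure on the contact hyperplanes `ker α`, compatible
with the symplectic form `dα` on them. Only the restriction of `j x` to `ker α x` matters; `j x`
is an arbitrary linear extension of it to the tangent space. -/
def Compatible (α : ContactForm m M)
    (j : ∀ x : M, TangentSpace (𝓡 (2 * m + 1)) x →L[ℝ] TangentSpace (𝓡 (2 * m + 1)) x) : Prop :=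
  ∀ x, ∀ u, α.toFun x u = 0 →
    α.toFun x (j x u) = 0 ∧ j x (j x u) = -u ∧
    (∀ v, α.toFun x v = 0 → dForm α.toFun x (j x u) (j x v) = dForm α.toFun x u v) ∧
    (u ≠ 0 → 0 < dForm α.toFun x u (j x u))

/-- `ℝ^{4n+3}` as the space `Im ℍ ⊕ ℍⁿ`, the orthogonal complement of the real unit `∂_r` of the
first factor in `ℍ^{n+1}`. -/
def ImH (n : ℕ) : Submodule ℝ (ℍ[ℝ] × (Fin n → ℍ[ℝ])) where
  carrier := {w | w.1.re = 0}
  add_mem' := by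
    intro a b ha hb
    simp only [Set.mem_ofPred_eq] at ha hb ⊢
    simp [ha, hb]
  zero_mem' := by simp
  smul_mem' := by
    intro c a ha
    simp only [Set.mem_ofPred_eq] at ha ⊢
    simp [ha]

/-- The unit imaginary quaternion `e₀ i + e₁ j + e₂ k` attached to a point of `S²`. -/
def unitIm (z : S2) : ℍ[ℝ] := ⟨0, z.1 0, z.1 1, z.1 2⟩

/-- The linear form `w ↦ ⟨𝐣 ∂_r, w⟩` on `ℝ^{4n+3}`, where `𝐣 = e₀ I + e₁ J + e₂ K` and `I`, `J`, `K`
are the left multiplications by `i`, `j`, `k`; its kernel is the space of `𝐣`-complex tangencies. -/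
def linearForm (n : ℕ) (z : S2) (w : ImH n) : ℝ := inner ℝ (unitIm z) w.1.1

/-- A contact sphere is almost-quaternionic: there are compatible almost complex structures
`j_z` on the structures `ξ(z)` (each of them smooth on `M`, and depending continuously on `z`), a
point `q` and a framing `τ : T_qM ≅ ℝ^{4n+3}` that carries `(ξ(z)_q, j_{z,q})`, with its
coorientation, to the member of the linear quaternionic sphere at `z`, namely the kernel of
`linearForm n z` with the left multiplication by `e₀ i + e₁ j + e₂ k`. -/
def ContactSphere.AlmostQuaternionic {ξ₀ : ContactStructure m M} (S : ContactSphere ξ₀) : Prop :=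
  ∃ j : S2 → ∀ x : M, TangentSpace (𝓡 (2 * m + 1)) x →L[ℝ] TangentSpace (𝓡 (2 * m + 1)) x,
    Continuous (fun p : S2 × M => TotalSpace.mk' (Model m →L[ℝ] Model m)
      (E := fun x : M => TangentSpace (𝓡 (2 * m + 1)) x →L[ℝ] TangentSpace (𝓡 (2 * m + 1)) x)
      p.2 (j p.1 p.2)) ∧
    (∀ z, ContMDiff (𝓡 (2 * m + 1)) ((𝓡 (2 * m + 1)).prod 𝓘(ℝ, Model m →L[ℝ] Model m)) ∞
      (fun x : M => TotalSpace.mk' (Model m →L[ℝ] Model m)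
        (E := fun x : M => TangentSpace (𝓡 (2 * m + 1)) x →L[ℝ] TangentSpace (𝓡 (2 * m + 1)) x)
        x (j z x))) ∧
    (∀ z, ∀ α : ContactForm m M, α.ker = (S.toMap z).1 → Compatible α (j z)) ∧
    ∃ (n : ℕ) (q : M) (τ : TangentSpace (𝓡 (2 * m + 1)) q ≃ₗ[ℝ] ImH n),
      ∀ z, ∀ α : ContactForm m M, α.ker = (S.toMap z).1 →
        (∃ c : ℝ, 0 < c ∧ ∀ u, α.toFun q u = c * linearForm n z (τ u)) ∧
        ∀ u, α.toFun q u = 0 → (τ (j z q u)).1 = unitIm z • (τ u).1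

end ContactSpheres

end

/-!
At the point `q` a contact form induces a linear contact structure on `T_qM`, and adding a line
`ℝ ∂_r` turns it into a symplectic form `B` on a Euclidean space. The orthogonal projection onto the
positive spectral subspace of the Hermitian matrix of `iB` does not change when the contact form is
rescaled by a positive function, and it depends continuously on the contact structure. A sphere of
contact structures thus gives a sphere of projections, that is, a complex vector bundle over `S²`.
The winding of the determinant of its clutching function, which is `2πi` times the first Chern
number up to sign, is a homotopy invariant and is additive under the multiplication in `π₂`.

For the linear quaternionic sphere the bundle consists of the `i`-eigenspaces of the complexified
left multiplications `L_z`. Conjugating by a family of quaternions that rotates a fixed direction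
to `z` trivializes it over the square that covers the sphere, and the winding is a nonzero multiple
of the trace of the projection. Hence no multiple of the class of the sphere has winding zero.
-/

noncomputable section

namespace ContactSpheres

/-! ### Continuous logarithms -/

section Logarithm

theorem exists_exp_eq (f : C(I × I, ℂ)) (hf : ∀ x, f x ≠ 0) :
    ∃ l : C(I × I, ℂ), ∀ x, Complex.exp (l x) = f x := by
  -- The plane retracts onto the square and is visibly simply connected.
  let r : C(ℝ × ℝ, I × I) :=
    let proj : C(ℝ, I) := ⟨Set.projIcc 0 1 zero_le_one, continuous_projIcc⟩
    proj.prodMap proj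
  let F : C(ℝ × ℝ, {z : ℂ // z ≠ 0}) := ⟨fun x => ⟨f (r x), hf _⟩, by fun_prop⟩
  obtain ⟨L, ⟨-, hL⟩, -⟩ := Complex.isCoveringMap_exp.existsUnique_continuousMap_lifts F 0
    (Complex.log (f (r 0))) (Subtype.ext (Complex.exp_log (hf _)))
  refine ⟨⟨fun x => L (x.1, x.2), by fun_prop⟩, fun x => ?_⟩
  simpa [F, r] using congrArg Subtype.val (congrFun hL ((x.1 : ℝ), (x.2 : ℝ)))

theorem eq_of_exp_eq_exp {X : Type*} [TopologicalSpace X] [PreconnectedSpace X] {f g : X → ℂ}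
    (hf : Continuous f) (hg : Continuous g) (h : ∀ x, Complex.exp (f x) = Complex.exp (g x))
    {x : X} (hx : f x = g x) (y : X) : f y = g y :=
  congrFun (Complex.isCoveringMap_exp.eq_of_comp_eq hf hg
    (funext fun z => Subtype.ext (h z)) x hx) y

theorem eq_of_exp_eq_one {X : Type*} [TopologicalSpace X] [PreconnectedSpace X] {f : X → ℂ}
    (hf : Continuous f) (h : ∀ x, Complex.exp (f x) = 1) (x y : X) : f x = f y :=
  eq_of_exp_eq_exp hf continuous_const (g := fun _ => f y)
    (fun z => (h z).trans (h y).symm) (x := y) rfl x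

theorem log_increment_eq_zero {f : C(I × I, ℂ)} (hf : ∀ p, f p ≠ 0)
    (hbottom : ∀ s, f (s, 0) = 1) (hleft : ∀ t, f (0, t) = 1) (hright : ∀ t, f (1, t) = 1)
    {l : I → ℂ} (hl : Continuous l) (hexp : ∀ s, Complex.exp (l s) = f (s, 1)) : l 1 = l 0 := by
  obtain ⟨L, hL⟩ := exists_exp_eq f hf
  have hside {γ : I → I × I} (hγ : Continuous γ) (h : ∀ t, f (γ t) = 1) : L (γ 0) = L (γ 1) :=
    eq_of_exp_eq_one (L.continuous.comp hγ) (fun t => (hL _).trans (h t)) 0 1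
  have htop : L (1, 1) = L (0, 1) :=
    calc L (1, 1) = L (1, 0) := (hside (γ := fun t => (1, t)) (by fun_prop) hright).symm
      _ = L (0, 0) := (hside (γ := fun t => (t, 0)) (by fun_prop) hbottom).symm
      _ = L (0, 1) := hside (γ := fun t => (0, t)) (by fun_prop) hleft
  have hdiff : l 1 - L (1, 1) = l 0 - L (0, 1) :=
    eq_of_exp_eq_one (f := fun s => l s - L (s, 1)) (by fun_prop)
      (fun s => by rw [Complex.exp_sub, hexp, hL, div_self (hf _)]) 1 0
  rwa [htop, sub_left_inj] at hdiff

end Logarithm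

/-! ### Transport of idempotents -/

section Transport

variable {A : Type*}

/-- The element comparing two idempotents: it carries the range of `q` into that of `p` and the
kernel of `q` into that of `p`, and it is invertible when `p` and `q` are close. -/
def idempotentTransfer [Ring A] (p q : A) : A := p * q + (1 - p) * (1 - q)

theorem idempotentTransfer_self [Ring A] {p : A} (hp : IsIdempotentElem p) :
    idempotentTransfer p p = 1 := by
  rw [idempotentTransfer, hp.eq, hp.one_sub.eq, add_sub_cancel]

theorem semiconjBy_idempotentTransfer [Ring A] {p q : A} (hp : IsIdempotentElem p)
    (hq : IsIdempotentElem q) : SemiconjBy (idempotentTransfer p q) q p := by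
  simp only [SemiconjBy, idempotentTransfer, add_mul, mul_add, mul_assoc, hq.eq,
    hq.one_sub_mul_self, mul_zero, add_zero]
  rw [← mul_assoc p p, hp.eq, ← mul_assoc p (1 - p), hp.mul_one_sub_self, zero_mul, add_zero]

theorem continuous_unit_of_isUnit [NormedRing A] [HasSummableGeomSeries A] {X : Type*}
    [TopologicalSpace X] {f : X → A} (hf : Continuous f) (h : ∀ x, IsUnit (f x)) :
    Continuous fun x => (h x).unit :=
  Units.isOpenEmbedding_val.isEmbedding.continuous_iff.2 hf

variable {X : Type*} [TopologicalSpace X]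

/-- The family of units `g` conjugates the family `P` over `X × I` to its restriction to
`X × {0}`, starting from `1` and trivially over the points where `P` does not depend on time. -/
structure IsTransport [NormedRing A] (P : X × I → A) (g : X × I → Aˣ) : Prop where
  continuous : Continuous g
  semiconjBy : ∀ x t, SemiconjBy (g (x, t) : A) (P (x, 0)) (P (x, t))
  initial : ∀ x, g (x, 0) = 1
  eq_one : ∀ x, (∀ t, P (x, t) = P (x, 0)) → ∀ t, g (x, t) = 1

variable [NormedRing A] [HasSummableGeomSeries A]

theorem exists_nhds_isUnit_idempotentTransfer [CompactSpace X] {P : X × I → A}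
    (hP : Continuous P) (hidem : ∀ p, IsIdempotentElem (P p)) (r : I) :
    ∃ V : Set I, IsOpen V ∧ r ∈ V ∧ ∀ s ∈ V, ∀ t ∈ V, ∀ x,
      IsUnit (idempotentTransfer (P (x, s)) (P (x, t))) := by
  have hT : Continuous fun p : (I × I) × X =>
      idempotentTransfer (P (p.2, p.1.1)) (P (p.2, p.1.2)) := by
    unfold idempotentTransfer
    fun_prop
  have hdiag (x : X) : IsUnit (idempotentTransfer (P (x, r)) (P (x, r))) := by
    rw [idempotentTransfer_self (hidem _)]
    exact isUnit_one
  have hnear : ∀ᶠ y : I × I in 𝓝 (r, r), ∀ x ∈ Set.univ,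
      IsUnit (idempotentTransfer (P (x, y.1)) (P (x, y.2))) :=
    isCompact_univ.eventually_forall_of_forall_eventually fun x _ =>
      hT.continuousAt.eventually (Units.isOpen.mem_nhds (hdiag x))
  obtain ⟨U, V, hU, hrU, hV, hrV, hUV⟩ := mem_nhds_prod_iff'.1 hnear
  exact ⟨U ∩ V, hU.inter hV, ⟨hrU, hrV⟩, fun s hs t ht x =>
    hUV (Set.mk_mem_prod hs.1 ht.2) x (Set.mem_univ x)⟩

theorem IsTransport.exists_extension {P : X × I → A} (hP : Continuous P)
    (hidem : ∀ p, IsIdempotentElem (P p)) {a b : I} (hab : a ≤ b)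
    (hunit : ∀ s ∈ Set.Icc a b, ∀ x, IsUnit (idempotentTransfer (P (x, s)) (P (x, a))))
    {g : X × I → Aˣ} (hg : IsTransport (fun p => P (p.1, p.2 ⊓ a)) g) :
    ∃ g' : X × I → Aˣ, IsTransport (fun p => P (p.1, p.2 ⊓ b)) g' := by
  have hu : ∀ p : X × I, IsUnit (idempotentTransfer (P (p.1, p.2 ⊓ b)) (P (p.1, p.2 ⊓ a))) := by
    rintro ⟨x, t⟩
    rcases le_total t a with h | h
    · rw [inf_of_le_left h, inf_of_le_left (h.trans hab), idempotentTransfer_self (hidem _)]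
      exact isUnit_one
    · rw [inf_of_le_right h]
      exact hunit _ ⟨le_inf h hab, inf_le_right⟩ x
  have hone {p : X × I} (h : P (p.1, p.2 ⊓ b) = P (p.1, p.2 ⊓ a)) : (hu p).unit = 1 :=
    Units.ext (by rw [IsUnit.unit_spec, h, idempotentTransfer_self (hidem _), Units.val_one])
  have hcont : Continuous fun p : X × I =>
      idempotentTransfer (P (p.1, p.2 ⊓ b)) (P (p.1, p.2 ⊓ a)) := by
    unfold idempotentTransfer
    fun_prop
  refine ⟨fun p => (hu p).unit * g p, (continuous_unit_of_isUnit hcont hu).mul hg.continuous,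
    fun x t => ?_, fun x => ?_, fun x hx t => ?_⟩
  · have h := (semiconjBy_idempotentTransfer (hidem (x, t ⊓ b)) (hidem (x, t ⊓ a))).mul_left
      (hg.semiconjBy x t)
    simpa only [Units.val_mul, IsUnit.unit_spec, inf_of_le_left unitInterval.nonneg'] using h
  · rw [hg.initial, mul_one]
    exact hone (by simp only [inf_of_le_left unitInterval.nonneg'])
  · have hconst : ∀ s ≤ b, P (x, s) = P (x, 0) := fun s hs => by
      simpa only [inf_of_le_left hs, inf_of_le_left unitInterval.nonneg'] using hx s
    rw [hg.eq_one x (fun s => ?_) t, mul_one]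
    · exact hone ((hconst _ inf_le_right).trans (hconst _ (inf_le_right.trans hab)).symm)
    · rw [hconst _ (inf_le_right.trans hab), hconst _ (inf_le_right.trans hab)]

theorem exists_isTransport [CompactSpace X] {P : X × I → A} (hP : Continuous P)
    (hidem : ∀ p, IsIdempotentElem (P p)) : ∃ g : X × I → Aˣ, IsTransport P g := by
  choose V hVo hmem hV using exists_nhds_isUnit_idempotentTransfer hP hidem
  obtain ⟨τ, hτ0, hmono, ⟨N, hN⟩, hsub⟩ := exists_monotone_Icc_subset_open_cover_unitInterval hVo
    fun s _ => Set.mem_iUnion.2 ⟨s, hmem s⟩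
  suffices h : ∀ k, ∃ g : X × I → Aˣ, IsTransport (fun p => P (p.1, p.2 ⊓ τ k)) g by
    simpa only [hN N le_rfl, inf_of_le_left unitInterval.le_one'] using h N
  intro k
  induction k with
  | zero =>
    simp only [hτ0, inf_of_le_right unitInterval.nonneg']
    exact ⟨fun _ => 1, continuous_const, fun _ _ => SemiconjBy.one_left _, fun _ => rfl,
      fun _ _ _ => rfl⟩
  | succ k ih =>
    obtain ⟨g, hg⟩ := ih
    obtain ⟨r, hr⟩ := hsub k
    have hle := hmono k.le_succ
    exact hg.exists_extension hP hidem hle fun s hs =>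
      hV r s (hr hs) _ (hr (Set.left_mem_Icc.2 hle))

end Transport

/-! ### The winding of a square of idempotent matrices -/

section RangeDet

variable {ι R : Type*} [Fintype ι] [DecidableEq ι] [CommRing R]

/-- The determinant of the map that a matrix `g` commuting with the idempotent `P` induces on the
range of `P`, encoded as the determinant of `g` on the range plus the identity on the kernel. -/
def rangeDet (P g : Matrix ι ι R) : R := (P * g + (1 - P)).det

theorem rangeDet_one (P : Matrix ι ι R) : rangeDet P 1 = 1 := by
  rw [rangeDet, mul_one, add_sub_cancel, Matrix.det_one]

theorem rangeDet_mul {P g : Matrix ι ι R} (hP : IsIdempotentElem P) (hg : Commute P g)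
    (h : Matrix ι ι R) : rangeDet P (g * h) = rangeDet P g * rangeDet P h := by
  have hrange : P * g * (P * h) = P * (g * h) := by
    rw [hg.eq, mul_assoc, ← mul_assoc P, hP.eq, ← mul_assoc, ← hg.eq, mul_assoc]
  have hker : P * g * (1 - P) = 0 := by
    rw [hg.eq, mul_assoc, hP.mul_one_sub_self, mul_zero]
  rw [rangeDet, rangeDet, rangeDet, ← Matrix.det_mul, add_mul, mul_add, mul_add, hrange, hker,
    ← mul_assoc (1 - P), hP.one_sub_mul_self, hP.one_sub.eq, zero_mul, add_zero, zero_add]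

theorem isUnit_rangeDet {P : Matrix ι ι R} (hP : IsIdempotentElem P) {g : (Matrix ι ι R)ˣ}
    (hg : Commute P g) : IsUnit (rangeDet P g) :=
  .of_mul_eq_one (rangeDet P ↑g⁻¹) (by rw [← rangeDet_mul hP hg, g.mul_inv, rangeDet_one])

theorem continuous_rangeDet [TopologicalSpace R] [IsTopologicalRing R] (P : Matrix ι ι R) :
    Continuous (rangeDet P) := by
  unfold rangeDet
  fun_prop

end RangeDet

section Winding

open scoped Matrix.Norms.L2Operator

variable {ι : Type*} [Fintype ι] [DecidableEq ι]

/-- `g` trivializes the family `P` of idempotents over the square, and is trivial on three of its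
sides. -/
structure IsTrivialization (P : I × I → Matrix ι ι ℂ) (g : I × I → (Matrix ι ι ℂ)ˣ) : Prop where
  continuous : Continuous g
  semiconjBy : ∀ p, SemiconjBy (g p : Matrix ι ι ℂ) (P 0) (P p)
  bottom : ∀ s, g (s, 0) = 1
  left : ∀ t, g (0, t) = 1
  right : ∀ t, g (1, t) = 1

/-- For a family `P` of idempotents that is constant on the boundary of the square, `d` is `2πi`
times the first Chern number (up to an orientation convention) of the bundle of their ranges over
the square modulo its boundary. It is computed by clutching: as the increment of the logarithm of
the determinant of a trivialization along the fourth side. -/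
def HasWinding (P : I × I → Matrix ι ι ℂ) (d : ℂ) : Prop :=
  ∃ g, IsTrivialization P g ∧ ∃ l : I → ℂ, Continuous l ∧
    (∀ s, Complex.exp (l s) = rangeDet (P 0) (g (s, 1))) ∧ l 1 - l 0 = d

theorem HasWinding.unique {P : I × I → Matrix ι ι ℂ} (hP : IsIdempotentElem (P 0))
    (htop : ∀ s, P (s, 1) = P 0) {d d' : ℂ} (h : HasWinding P d) (h' : HasWinding P d') :
    d = d' := by
  obtain ⟨g, hg, l, hlc, hl, rfl⟩ := h
  obtain ⟨g', hg', l', hlc', hl', rfl⟩ := h'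
  let k : I × I → (Matrix ι ι ℂ)ˣ := fun p => (g' p)⁻¹ * g p
  have hk (p) : Commute (P 0) (k p) := by
    have := (SemiconjBy.units_inv_symm_left (hg'.semiconjBy p)).mul_left (hg.semiconjBy p)
    rw [← Units.val_mul] at this
    exact Commute.symm this
  have hkc : Continuous k := hg'.continuous.inv.mul hg.continuous
  let f : C(I × I, ℂ) := ⟨fun p => rangeDet (P 0) (k p),
    (continuous_rangeDet _).comp (Units.continuous_val.comp hkc)⟩
  have hf (p) : f p ≠ 0 := (isUnit_rangeDet hP (hk p)).ne_zero
  have hf1 {p} (hp : g p = 1) (hp' : g' p = 1) : f p = 1 := by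
    simp only [f, k, ContinuousMap.coe_mk, hp, hp', inv_one, mul_one, Units.val_one, rangeDet_one]
  have hexp (s) : Complex.exp (l s - l' s) = f (s, 1) := by
    have hc' : Commute (P 0) (g' (s, 1) : Matrix ι ι ℂ) := by
      have := hg'.semiconjBy (s, 1)
      rw [htop] at this
      exact Commute.symm this
    have hgk : (g (s, 1) : Matrix ι ι ℂ) = g' (s, 1) * k (s, 1) := by
      rw [← Units.val_mul, mul_inv_cancel_left]
    rw [Complex.exp_sub, hl, hl', hgk, rangeDet_mul hP hc',
      mul_div_cancel_left₀ _ (isUnit_rangeDet hP hc').ne_zero]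
    rfl
  have hzero := log_increment_eq_zero hf (fun s => hf1 (hg.bottom s) (hg'.bottom s))
    (fun t => hf1 (hg.left t) (hg'.left t)) (fun t => hf1 (hg.right t) (hg'.right t))
    (l := fun s => l s - l' s) (by fun_prop) hexp
  linear_combination hzero

theorem HasWinding.const (A : Matrix ι ι ℂ) : HasWinding (fun _ => A) 0 :=
  ⟨fun _ => 1, ⟨continuous_const, fun _ => SemiconjBy.one_left _, fun _ => rfl, fun _ => rfl,
    fun _ => rfl⟩, fun _ => 0, continuous_const,
    fun _ => by rw [Complex.exp_zero, Units.val_one, rangeDet_one], sub_zero 0⟩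

theorem IsTransport.isTrivialization {P : (I × I) × I → Matrix ι ι ℂ} {A : Matrix ι ι ℂ}
    (hA : ∀ r s t, s = 0 ∨ s = 1 ∨ t = 0 ∨ t = 1 → P ((r, s), t) = A)
    {g : (I × I) × I → (Matrix ι ι ℂ)ˣ} (hg : IsTransport P g) (r : I) :
    IsTrivialization (fun p => P ((r, p.1), p.2)) fun p => g ((r, p.1), p.2) where
  continuous := hg.continuous.comp (by fun_prop)
  semiconjBy p := by
    have h0 : P ((r, 0), 0) = P ((r, p.1), 0) :=
      (hA _ _ _ (.inl rfl)).trans (hA _ _ _ (.inr <| .inr <| .inl rfl)).symm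
    change SemiconjBy _ (P ((r, 0), 0)) _
    rw [h0]
    exact hg.semiconjBy _ _
  bottom s := hg.initial _
  left t := hg.eq_one _ (fun t => (hA _ _ _ (.inl rfl)).trans (hA _ _ _ (.inl rfl)).symm) t
  right t := hg.eq_one _
    (fun t => (hA _ _ _ (.inr <| .inl rfl)).trans (hA _ _ _ (.inr <| .inl rfl)).symm) t

theorem HasWinding.eq_of_homotopy {P : (I × I) × I → Matrix ι ι ℂ} {A : Matrix ι ι ℂ}
    (hP : Continuous P) (hidem : ∀ p, IsIdempotentElem (P p))
    (hA : ∀ r s t, s = 0 ∨ s = 1 ∨ t = 0 ∨ t = 1 → P ((r, s), t) = A) {d d' : ℂ}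
    (h : HasWinding (fun p => P ((0, p.1), p.2)) d)
    (h' : HasWinding (fun p => P ((1, p.1), p.2)) d') : d = d' := by
  obtain ⟨g, hg⟩ := exists_isTransport hP hidem
  have hAidem : IsIdempotentElem A := hA 0 0 0 (.inl rfl) ▸ hidem _
  have hbase (r) : P ((r, 0), 0) = A := hA _ _ _ (.inl rfl)
  have hcomm (p) : Commute A (g (p, 1) : Matrix ι ι ℂ) := by
    have := hg.semiconjBy p 1
    rw [hA p.1 p.2 0 (.inr <| .inr <| .inl rfl), hA p.1 p.2 1 (.inr <| .inr <| .inr rfl)] at this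
    exact Commute.symm this
  have hfc : Continuous fun p : I × I => rangeDet A (g (p, 1)) :=
    (continuous_rangeDet A).comp (Units.continuous_val.comp (hg.continuous.comp (by fun_prop)))
  obtain ⟨L, hL⟩ := exists_exp_eq ⟨fun p => rangeDet A (g (p, 1)), hfc⟩
    fun p => (isUnit_rangeDet hAidem (hcomm p)).ne_zero
  have hw (r) : HasWinding (fun p => P ((r, p.1), p.2)) (L (r, 1) - L (r, 0)) :=
    ⟨_, hg.isTrivialization hA r, fun s => L (r, s), by fun_prop,
      fun s => (hL _).trans (congrArg (rangeDet · _) (hbase r).symm), rfl⟩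
  have hunique (r) {c c' : ℂ} : HasWinding (fun p => P ((r, p.1), p.2)) c →
      HasWinding (fun p => P ((r, p.1), p.2)) c' → c = c' :=
    HasWinding.unique (hidem _) fun s =>
      (hA r s 1 (.inr <| .inr <| .inr rfl)).trans (hbase r).symm
  have hside (s : I) (hs : ∀ r, g ((r, s), 1) = 1) : L (0, s) = L (1, s) :=
    eq_of_exp_eq_one (f := fun r : I => L (r, s)) (by fun_prop)
      (fun r => by rw [hL, ContinuousMap.coe_mk, hs, Units.val_one, rangeDet_one]) 0 1
  rw [hunique 0 h (hw 0), hunique 1 h' (hw 1),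
    hside 0 fun r => (hg.isTrivialization hA r).left 1,
    hside 1 fun r => (hg.isTrivialization hA r).right 1]

end Winding

section Concat

/-- The concatenation in the first variable of two functions on `I × X`, meaningful if they agree
where they are glued. -/
def concat {X Y : Type*} (f g : I × X → Y) (p : I × X) : Y :=
  if (p.1 : ℝ) ≤ 1 / 2 then f (Set.projIcc 0 1 zero_le_one (2 * p.1), p.2)
  else g (Set.projIcc 0 1 zero_le_one (2 * p.1 - 1), p.2)

theorem concat_zero {X Y : Type*} (f g : I × X → Y) (x : X) : concat f g (0, x) = f (0, x) := by
  simp [concat]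

theorem concat_one {X Y : Type*} (f g : I × X → Y) (x : X) : concat f g (1, x) = g (1, x) := by
  norm_num [concat]

theorem continuous_concat {X Y : Type*} [TopologicalSpace X] [TopologicalSpace Y]
    {f g : I × X → Y} (hf : Continuous f) (hg : Continuous g) (h : ∀ x, f (1, x) = g (0, x)) :
    Continuous (concat f g) := by
  have := continuous_projIcc (a := (0 : ℝ)) (b := 1) (h := zero_le_one)
  refine Continuous.if_le (by fun_prop) (by fun_prop) (by fun_prop) (by fun_prop) fun p hp => ?_
  rw [hp, mul_one_div_cancel two_ne_zero, sub_self, Set.projIcc_left, Set.projIcc_right]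
  exact h _

open scoped Matrix.Norms.L2Operator

variable {ι : Type*} [Fintype ι] [DecidableEq ι]

theorem IsTrivialization.concat {P P' : I × I → Matrix ι ι ℂ} (h0 : P 0 = P' 0)
    {g g' : I × I → (Matrix ι ι ℂ)ˣ} (hg : IsTrivialization P g) (hg' : IsTrivialization P' g') :
    IsTrivialization (concat P P') (concat g g') where
  continuous := continuous_concat hg.continuous hg'.continuous fun t => by rw [hg.right, hg'.left]
  semiconjBy p := by
    rw [← Prod.mk_zero_zero, concat_zero]
    unfold ContactSpheres.concat
    split_ifs
    exacts [hg.semiconjBy _, h0 ▸ hg'.semiconjBy _]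
  bottom s := by
    unfold ContactSpheres.concat
    split_ifs
    exacts [hg.bottom _, hg'.bottom _]
  left t := by rw [concat_zero, hg.left]
  right t := by rw [concat_one, hg'.right]

theorem HasWinding.concat {P P' : I × I → Matrix ι ι ℂ} (h0 : P 0 = P' 0) {d d' : ℂ}
    (h : HasWinding P d) (h' : HasWinding P' d') : HasWinding (concat P P') (d + d') := by
  obtain ⟨g, hg, l, hlc, hl, rfl⟩ := h
  obtain ⟨g', hg', l', hlc', hl', rfl⟩ := h'
  have hend : Complex.exp (l 1) = 1 := by rw [hl, hg.right, Units.val_one, rangeDet_one]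
  have hstart : Complex.exp (l' 0) = 1 := by rw [hl', hg'.left, Units.val_one, rangeDet_one]
  let L : I × Unit → ℂ :=
    ContactSpheres.concat (fun p => l p.1) (fun p => l' p.1 - l' 0 + l 1)
  have hL : Continuous L := continuous_concat (by fun_prop) (by fun_prop) (by simp)
  refine ⟨_, hg.concat h0 hg', fun s => L (s, ()), by fun_prop, fun s => ?_, ?_⟩
  · rw [← Prod.mk_zero_zero, concat_zero]
    simp only [L, ContactSpheres.concat]
    split_ifs
    · exact hl _
    · rw [Complex.exp_add, Complex.exp_sub, hstart, hend, hl', div_one, mul_one, ← h0]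
      rfl
  · simp only [L, concat_zero, concat_one]
    ring

end Concat

/-! ### Winding and the second homotopy group -/

section HomotopyGroup

open scoped Matrix.Norms.L2Operator

variable {ι : Type*} [Fintype ι] [DecidableEq ι] {X : Type*} [TopologicalSpace X] {x : X}

/-- A two-dimensional loop, as a function of a pair of parameters instead of a function on a
cube. -/
def square (p : GenLoop (Fin 2) X x) (s : I × I) : X := p ![s.1, s.2]

theorem vec_mem_boundary {s t : I} (h : s = 0 ∨ s = 1 ∨ t = 0 ∨ t = 1) :
    ![s, t] ∈ Cube.boundary (Fin 2) := by
  rcases h with h | h | h | h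
  exacts [⟨0, .inl h⟩, ⟨0, .inr h⟩, ⟨1, .inl h⟩, ⟨1, .inr h⟩]

theorem square_transAt (p q : GenLoop (Fin 2) X x) :
    square (GenLoop.transAt 0 p q) = concat (square p) (square q) := by
  have hupdate (a b c : I) : Function.update ![a, b] 0 c = ![c, b] := by
    ext i
    fin_cases i <;> simp
  funext s
  simp only [square, GenLoop.transAt, GenLoop.coe_copy, concat, Matrix.cons_val_zero, hupdate]

variable {Φ : X → Matrix ι ι ℂ}

theorem HasWinding.transAt {p q : GenLoop (Fin 2) X x} {d d' : ℂ}
    (h : HasWinding (Φ ∘ square p) d) (h' : HasWinding (Φ ∘ square q) d') :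
    HasWinding (Φ ∘ square (GenLoop.transAt 0 p q)) (d + d') := by
  have hbase (r : GenLoop (Fin 2) X x) : (Φ ∘ square r) 0 = Φ x :=
    congrArg Φ (r.2 _ (vec_mem_boundary (.inl rfl)))
  have hcomp : Φ ∘ square (GenLoop.transAt 0 p q) =
      ContactSpheres.concat (Φ ∘ square p) (Φ ∘ square q) := by
    rw [square_transAt]
    ext1 s
    exact apply_ite Φ _ _ _
  rw [hcomp]
  exact h.concat ((hbase p).trans (hbase q).symm) h'

theorem HasWinding.eq_of_homotopic (hΦ : Continuous Φ) (hidem : ∀ y, IsIdempotentElem (Φ y))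
    {p q : GenLoop (Fin 2) X x} (hpq : GenLoop.Homotopic p q) {d d' : ℂ}
    (h : HasWinding (Φ ∘ square p) d) (h' : HasWinding (Φ ∘ square q) d') : d = d' := by
  obtain ⟨F⟩ := hpq
  have hvec : Continuous fun s : (I × I) × I => (s.1.1, ![s.1.2, s.2]) := by
    refine continuous_fst.fst.prodMk (continuous_pi fun i => ?_)
    fin_cases i
    exacts [continuous_fst.snd, continuous_snd]
  refine HasWinding.eq_of_homotopy (P := fun s => Φ (F (s.1.1, ![s.1.2, s.2]))) (A := Φ x)
    (hΦ.comp (F.continuous.comp hvec)) (fun _ => hidem _) (fun r s t hst => ?_)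
    (d := d) (d' := d') ?_ ?_
  · have hmem := vec_mem_boundary hst
    exact congrArg Φ ((F.eq_fst r hmem).trans (p.2 _ hmem))
  · simp only [F.apply_zero]
    exact h
  · simp only [F.apply_one]
    exact h'

/-- The element of the second homotopy group that a two-dimensional loop represents. -/
def loopClass (p : GenLoop (Fin 2) X x) : HomotopyGroup.Pi 2 X x := Quotient.mk _ p

theorem HasWinding.exists_pow {p : GenLoop (Fin 2) X x} {d : ℂ}
    (h : HasWinding (Φ ∘ square p) d) (k : ℕ) : ∃ q : GenLoop (Fin 2) X x,
      loopClass p ^ k = loopClass q ∧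
      HasWinding (Φ ∘ square q) (k * d) := by
  induction k with
  | zero =>
    rw [Nat.cast_zero, zero_mul]
    exact ⟨GenLoop.const, pow_zero _, HasWinding.const (Φ x)⟩
  | succ k ih =>
    obtain ⟨q, hq, hw⟩ := ih
    refine ⟨GenLoop.transAt 0 p q, ?_, ?_⟩
    · rw [pow_succ, hq]
      exact HomotopyGroup.mul_spec
    · rw [Nat.cast_succ, add_one_mul, add_comm]
      exact h.transAt hw

theorem HasWinding.not_isOfFinOrder (hΦ : Continuous Φ) (hidem : ∀ y, IsIdempotentElem (Φ y))
    {p : GenLoop (Fin 2) X x} {d : ℂ} (hd : d ≠ 0) (h : HasWinding (Φ ∘ square p) d) :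
    ¬ IsOfFinOrder (loopClass p) := by
  intro hfin
  obtain ⟨k, hk, hpow⟩ := isOfFinOrder_iff_pow_eq_one.1 hfin
  obtain ⟨q, hq, hw⟩ := h.exists_pow k
  have hnull : GenLoop.Homotopic q GenLoop.const := Quotient.exact (hq.symm.trans hpow)
  have hzero : (k : ℂ) * d = 0 :=
    hw.eq_of_homotopic hΦ hidem hnull (HasWinding.const (Φ x))
  exact (mul_ne_zero (Nat.cast_ne_zero.2 hk.ne') hd) hzero

end HomotopyGroup

/-! ### The positive spectral projection -/

section PositiveProjection

theorem isIdempotentElem_half_smul_one_add {A : Type*} [Ring A] [Algebra ℂ A] {s : A}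
    (hs : s * s = 1) : IsIdempotentElem ((1 / 2 : ℂ) • (1 + s)) := by
  have : (1 + s) * (1 + s) = (2 : ℂ) • (1 + s) := by
    rw [mul_add, add_mul, add_mul, hs, one_mul, mul_one, one_mul, add_comm s 1, two_smul]
  rw [IsIdempotentElem, smul_mul_smul_comm, this, smul_smul]
  norm_num

variable {A : Type*} [CStarAlgebra A] [PartialOrder A] [StarOrderedRing A]

/-- The spectral projection `½(1 + a|a|⁻¹)` of an invertible self-adjoint element `a` onto the
positive part of its spectrum. -/
def positiveProjection (a : A) : A := (1 / 2 : ℂ) • (1 + a * Ring.inverse (CFC.abs a))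

theorem isUnit_abs {a : A} (ha : IsSelfAdjoint a) (hu : IsUnit a) : IsUnit (CFC.abs a) := by
  have h : CFC.abs a * CFC.abs a = a * a := by rw [CFC.abs_mul_abs, ha.star_eq]
  exact (isUnit_pow_iff two_ne_zero).1 (by rw [sq, h]; exact hu.mul hu)

theorem isIdempotentElem_positiveProjection {a : A} (ha : IsSelfAdjoint a) (hu : IsUnit a) :
    IsIdempotentElem (positiveProjection a) := by
  obtain ⟨r, hr⟩ := isUnit_abs ha hu
  have hcomm : Commute a ↑r⁻¹ := Commute.units_inv_right (hr ▸ (CFC.commute_abs_self a).symm)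
  have hsq : a * a = r * r := by rw [hr, CFC.abs_mul_abs, ha.star_eq]
  rw [positiveProjection, ← hr, Ring.inverse_unit]
  refine isIdempotentElem_half_smul_one_add ?_
  calc a * ↑r⁻¹ * (a * ↑r⁻¹) = a * a * (↑r⁻¹ * ↑r⁻¹) := hcomm.symm.mul_mul_mul_comm _ _
    _ = 1 := by rw [hsq, mul_assoc, ← mul_assoc (r : A) ↑r⁻¹, r.mul_inv, one_mul, r.mul_inv]

theorem continuous_positiveProjection {X : Type*} [TopologicalSpace X] {a : X → A}
    (hc : Continuous a) (ha : ∀ x, IsSelfAdjoint (a x)) (hu : ∀ x, IsUnit (a x)) :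
    Continuous fun x => positiveProjection (a x) := by
  have habs : Continuous fun x => Ring.inverse (CFC.abs (a x)) :=
    continuous_iff_continuousAt.2 fun x =>
      ContinuousAt.comp (g := Ring.inverse)
        (by simpa using NormedRing.inverse_continuousAt (isUnit_abs (ha x) (hu x)).unit)
        (CFC.continuous_abs.comp hc).continuousAt
  unfold positiveProjection
  fun_prop

theorem positiveProjection_mul {s k : A} (hs : 0 ≤ s) (hu : IsUnit s) (hsk : Commute s k)
    (hk : k * k = 1) (ha : IsSelfAdjoint (s * k)) :
    positiveProjection (s * k) = (1 / 2 : ℂ) • (1 + k) := by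
  have habs : CFC.abs (s * k) = s := by
    refine CFC.sqrt_unique ?_ hs
    rw [ha.star_eq, mul_assoc, ← mul_assoc k, ← hsk.eq, mul_assoc, hk, mul_one]
  rw [positiveProjection, habs, hsk.eq, mul_assoc, Ring.mul_inverse_cancel _ hu, mul_one]

end PositiveProjection

section ExpDet

theorem det_smul_add_one_sub_of_isIdempotentElem {K V : Type*} [Field K] [AddCommGroup V]
    [Module K V] [FiniteDimensional K V] {f : Module.End K V} (hf : IsIdempotentElem f) (c : K) :
    LinearMap.det (c • f + (1 - f)) = c ^ Module.finrank K (LinearMap.range f) := by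
  have hproj := LinearMap.IsIdempotentElem.isProj_range f hf
  let e := (LinearMap.range f).prodEquivOfIsCompl (LinearMap.ker f) hproj.isCompl
  have hsplit : c • f + (1 - f) =
      e.conj ((c • LinearMap.id).prodMap LinearMap.id) := by
    have hf' : f = e.conj (LinearMap.id.prodMap 0) := hproj.eq_conj_prodMap
    have hone : (1 : Module.End K V) = e.conj LinearMap.id := (e.conj_id).symm
    calc c • f + (1 - f)
        = c • e.conj (LinearMap.id.prodMap 0) +
            (e.conj LinearMap.id - e.conj (LinearMap.id.prodMap 0)) := by rw [← hf', ← hone]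
      _ = e.conj (c • LinearMap.id.prodMap 0 + (LinearMap.id - LinearMap.id.prodMap 0)) := by
          rw [map_add, map_smul, map_sub]
      _ = e.conj ((c • LinearMap.id).prodMap LinearMap.id) := by
          congr 1
          ext <;> simp
  rw [hsplit, LinearEquiv.conj_apply, LinearMap.comp_assoc, LinearMap.det_conj,
    LinearMap.det_prodMap, LinearMap.det_smul, LinearMap.det_id, mul_one, LinearMap.det_id, mul_one]

theorem det_exp_smul_add_one_sub {ι : Type*} [Fintype ι] [DecidableEq ι] {P : Matrix ι ι ℂ}
    (hP : IsIdempotentElem P) (l : ℂ) :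
    (Complex.exp l • P + (1 - P)).det = Complex.exp (l * P.trace) := by
  have hf : IsIdempotentElem (Matrix.toLin' P) := hP.map (Matrix.toLinAlgEquiv' (R := ℂ))
  have htrace : P.trace = Module.finrank ℂ (LinearMap.range (Matrix.toLin' P)) := by
    rw [← Matrix.trace_toLin'_eq, (LinearMap.IsIdempotentElem.isProj_range _ hf).trace]
  rw [← LinearMap.det_toLin', map_add, map_smul, map_sub, Matrix.toLin'_one,
    htrace, mul_comm, Complex.exp_nat_mul]
  exact det_smul_add_one_sub_of_isIdempotentElem hf _

end ExpDet

/-! ### Nondegeneracy of linear contact structures -/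

theorem exists_basis_adapted {K V : Type*} [Field K] [AddCommGroup V] [Module K V]
    [FiniteDimensional K V] {n : ℕ} (hdim : Module.finrank K V = n + 1)
    {a : V →ₗ[K] K} (ha : a ≠ 0) {u : V} (hu : u ≠ 0) (hau : a u = 0) :
    ∃ b : Module.Basis (Fin (n + 1)) K V, (∀ i, i ≠ 0 → a (b i) = 0) ∧ ∃ j, j ≠ 0 ∧ b j = u := by
  obtain ⟨y, hy⟩ := DFunLike.exists_ne ha
  have hker : Module.finrank K (LinearMap.ker a) = n := by
    have h := a.finrank_range_add_finrank_ker
    rw [LinearMap.range_eq_top.2 (LinearMap.surjective ha), finrank_top,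
      Module.finrank_self] at h
    omega
  let u' : LinearMap.ker a := ⟨u, hau⟩
  have hu' : LinearIndepOn K id ({u'} : Set (LinearMap.ker a)) :=
    LinearIndepOn.singleton (by simpa [u', Subtype.ext_iff] using hu)
  let b₀ := Module.Basis.extend hu'
  have : Fintype (hu'.extend (Set.subset_univ _)) := FiniteDimensional.fintypeBasisIndex b₀
  let e : hu'.extend (Set.subset_univ _) ≃ Fin n :=
    Fintype.equivFinOfCardEq (by rw [← Module.finrank_eq_card_basis b₀, hker])
  let b := Module.Basis.mkFinCons y (b₀.reindex e)
    (fun c x hx h => by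
      have h1 := congrArg a h
      rw [map_add, map_smul, LinearMap.mem_ker.1 hx, map_zero, add_zero, smul_eq_mul] at h1
      exact (mul_eq_zero.1 h1).resolve_right hy)
    (fun z => ⟨-(a z / a y), by simp [div_mul_cancel₀ _ hy]⟩)
  have hb (i : Fin n) : b i.succ = (b₀.reindex e i : V) := by
    simp [b, Module.Basis.coe_mkFinCons]
  refine ⟨b, fun i hi => ?_, (e ⟨u', hu'.subset_extend _ rfl⟩).succ, Fin.succ_ne_zero _, ?_⟩
  · obtain ⟨k, rfl⟩ := Fin.exists_succ_eq.2 hi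
    rw [hb]
    exact (b₀.reindex e k).2
  · rw [hb]
    simp [b₀, u']

theorem exists_eq_or_eq_of_ne_zero {m k : ℕ} (hk : k < 2 * m + 1) (hk0 : k ≠ 0) :
    ∃ i : Fin m, k = 2 * i + 1 ∨ k = 2 * i + 2 :=
  ⟨⟨(k - 1) / 2, by omega⟩, by dsimp only; omega⟩

section Wedge

variable {V : Type*} [AddCommGroup V] [Module ℝ V] {m : ℕ}

theorem tensor_update_eq_mul (a : V →ₗ[ℝ] ℝ) (Ω : V →ₗ[ℝ] V →ₗ[ℝ] ℝ) (v : Fin (2 * m + 1) → V)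
    (i : Fin m) {k : ℕ} (hk : k < 2 * m + 1) (hki : k = 2 * i + 1 ∨ k = 2 * i + 2) (x : V) :
    a (Function.update v ⟨k, hk⟩ x ⟨0, by omega⟩) * ∏ l : Fin m,
        Ω (Function.update v ⟨k, hk⟩ x ⟨2 * l + 1, by omega⟩)
          (Function.update v ⟨k, hk⟩ x ⟨2 * l + 2, by omega⟩) =
      (a (v ⟨0, by omega⟩) * ∏ l ∈ Finset.univ.erase i,
        Ω (v ⟨2 * l + 1, by omega⟩) (v ⟨2 * l + 2, by omega⟩)) *
        Ω (Function.update v ⟨k, hk⟩ x ⟨2 * i + 1, by omega⟩)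
          (Function.update v ⟨k, hk⟩ x ⟨2 * i + 2, by omega⟩) := by
  have hne (l : ℕ) (hl : l < 2 * m + 1) (h : l ≠ k) :
      Function.update v ⟨k, hk⟩ x ⟨l, hl⟩ = v ⟨l, hl⟩ :=
    Function.update_of_ne (by simpa using h) _ _
  have hprod : ∏ l ∈ Finset.univ.erase i,
      Ω (Function.update v ⟨k, hk⟩ x ⟨2 * l + 1, by omega⟩)
        (Function.update v ⟨k, hk⟩ x ⟨2 * l + 2, by omega⟩) =
      ∏ l ∈ Finset.univ.erase i, Ω (v ⟨2 * l + 1, by omega⟩) (v ⟨2 * l + 2, by omega⟩) := by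
    refine Finset.prod_congr rfl fun l hl => ?_
    have hli : (l : ℕ) ≠ i := fun h => Finset.ne_of_mem_erase hl (Fin.ext h)
    rw [hne _ _ (by omega), hne _ _ (by omega)]
  rw [← Finset.mul_prod_erase _ _ (Finset.mem_univ i), hne 0 _ (by omega), hprod]
  ring

theorem exists_linear_update (a : V →ₗ[ℝ] ℝ) (Ω : V →ₗ[ℝ] V →ₗ[ℝ] ℝ)
    (v : Fin (2 * m + 1) → V) (j : Fin (2 * m + 1)) : ∃ f : V →ₗ[ℝ] ℝ, ∀ x,
      a (Function.update v j x ⟨0, by omega⟩) * ∏ i : Fin m,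
        Ω (Function.update v j x ⟨2 * i + 1, by omega⟩)
          (Function.update v j x ⟨2 * i + 2, by omega⟩) = f x := by
  obtain ⟨k, hk⟩ := j
  rcases eq_or_ne k 0 with rfl | hk0
  · refine ⟨(∏ i : Fin m, Ω (v ⟨2 * i + 1, by omega⟩) (v ⟨2 * i + 2, by omega⟩)) • a,
      fun x => ?_⟩
    rw [Function.update_self, LinearMap.smul_apply, smul_eq_mul, mul_comm]
    congr 1
  · obtain ⟨i, hi⟩ := exists_eq_or_eq_of_ne_zero hk hk0
    simp only [tensor_update_eq_mul a Ω v i hk hi]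
    generalize a _ * ∏ l ∈ _, _ = R
    rcases hi with rfl | rfl
    · refine ⟨R • Ω.flip (v ⟨2 * i + 2, by omega⟩), fun x => ?_⟩
      rw [Function.update_self, Function.update_of_ne (by simp)]
      simp
    · refine ⟨R • Ω (v ⟨2 * i + 1, by omega⟩), fun x => ?_⟩
      rw [Function.update_self, Function.update_of_ne (by simp)]
      simp

/-- The tensor `a ⊗ Ω ⊗ ⋯ ⊗ Ω`, of which `wedgePow` is the antisymmetrization. -/
def tensorPow (m : ℕ) (a : V →ₗ[ℝ] ℝ) (Ω : V →ₗ[ℝ] V →ₗ[ℝ] ℝ) :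
    MultilinearMap ℝ (fun _ : Fin (2 * m + 1) => V) ℝ where
  toFun v := a (v ⟨0, by omega⟩) *
    ∏ i : Fin m, Ω (v ⟨2 * i + 1, by omega⟩) (v ⟨2 * i + 2, by omega⟩)
  map_update_add' {inst} v j x y := by
    obtain rfl : inst = instDecidableEqFin _ := Subsingleton.elim _ _
    obtain ⟨f, hf⟩ := exists_linear_update a Ω v j
    rw [hf, hf, hf, map_add]
  map_update_smul' {inst} v j c x := by
    obtain rfl : inst = instDecidableEqFin _ := Subsingleton.elim _ _
    obtain ⟨f, hf⟩ := exists_linear_update a Ω v j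
    rw [hf, hf, map_smul]

theorem wedgePow_eq_alternatization (a : V →ₗ[ℝ] ℝ) (Ω : V →ₗ[ℝ] V →ₗ[ℝ] ℝ)
    (v : Fin (2 * m + 1) → V) :
    wedgePow m a (fun x y => Ω x y) v = MultilinearMap.alternatization (tensorPow m a Ω) v := by
  rw [MultilinearMap.alternatization_apply, wedgePow]
  refine Finset.sum_congr rfl fun s _ => ?_
  rw [Units.smul_def, zsmul_eq_mul]
  rfl

theorem tensorPow_basis_eq_zero {a : V →ₗ[ℝ] ℝ} {Ω : V →ₗ[ℝ] V →ₗ[ℝ] ℝ}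
    {b : Fin (2 * m + 1) → V} (hb : ∀ i, i ≠ 0 → a (b i) = 0) {j : Fin (2 * m + 1)} (hj : j ≠ 0)
    (hl : ∀ w, a w = 0 → Ω (b j) w = 0) (hr : ∀ w, a w = 0 → Ω w (b j) = 0)
    (s : Equiv.Perm (Fin (2 * m + 1))) : tensorPow m a Ω (b ∘ s) = 0 := by
  change a (b (s 0)) * ∏ i : Fin m, Ω (b (s ⟨2 * i + 1, _⟩)) (b (s ⟨2 * i + 2, _⟩)) = 0
  by_cases hs : s 0 = 0
  · have hs' (k) (hk : k ≠ 0) : a (b (s k)) = 0 := hb _ (hs ▸ s.injective.ne hk)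
    obtain ⟨⟨k, hk⟩, rfl⟩ := s.surjective j
    have hk0 : k ≠ 0 := fun h => hj (by subst h; exact hs)
    obtain ⟨i, hi⟩ := exists_eq_or_eq_of_ne_zero hk hk0
    rw [Finset.prod_eq_zero (Finset.mem_univ i), mul_zero]
    rcases hi with rfl | rfl
    · exact hl _ (hs' _ (by simp [Fin.ext_iff]))
    · exact hr _ (hs' _ (by simp [Fin.ext_iff]))
  · rw [hb _ hs, zero_mul]

theorem eq_zero_of_wedgePow_ne_zero [FiniteDimensional ℝ V]
    (hdim : Module.finrank ℝ V = 2 * m + 1) {a : V →ₗ[ℝ] ℝ} {Ω : V →ₗ[ℝ] V →ₗ[ℝ] ℝ}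
    {v : Fin (2 * m + 1) → V} (hv : wedgePow m a (fun x y => Ω x y) v ≠ 0)
    {u : V} (hau : a u = 0) (hl : ∀ w, a w = 0 → Ω u w = 0) (hr : ∀ w, a w = 0 → Ω w u = 0) :
    u = 0 := by
  by_contra hu
  have ha : a ≠ 0 := by
    rintro rfl
    exact hv (by simp [wedgePow])
  obtain ⟨b, hb, j, hj, rfl⟩ := exists_basis_adapted hdim ha hu hau
  apply hv
  rw [wedgePow_eq_alternatization]
  suffices MultilinearMap.alternatization (tensorPow m a Ω) = 0 by rw [this]; rfl
  rw [← AlternatingMap.map_basis_eq_zero_iff b, MultilinearMap.alternatization_apply]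
  exact Finset.sum_eq_zero fun s _ =>
    (congrArg _ (tensorPow_basis_eq_zero hb hj hl hr s)).trans (smul_zero _)

end Wedge

section ComplexEigenprojection

variable {A : Type*} [Ring A] [Algebra ℂ A]

/-- The projection to the `i`-eigenspace of a complex structure `J`, that is, of an element with
`J ^ 2 = -1`. -/
def complexEigenprojection (J : A) : A := (1 / 2 : ℂ) • (1 + (-Complex.I) • J)

theorem neg_I_smul_mul_self {J : A} (hJ : J * J = -1) :
    ((-Complex.I) • J) * ((-Complex.I) • J) = 1 := by
  rw [smul_mul_smul_comm, hJ, neg_mul_neg, Complex.I_mul_I, neg_smul, one_smul, neg_neg]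

theorem isIdempotentElem_complexEigenprojection {J : A} (hJ : J * J = -1) :
    IsIdempotentElem (complexEigenprojection J) :=
  isIdempotentElem_half_smul_one_add (neg_I_smul_mul_self hJ)

theorem semiconjBy_complexEigenprojection {g J J' : A} (h : SemiconjBy g J J') :
    SemiconjBy g (complexEigenprojection J) (complexEigenprojection J') :=
  ((SemiconjBy.one_right g).add_right (h.smul_right _)).smul_right _

theorem complexEigenprojection_mul_self {J : A} (hJ : J * J = -1) :
    complexEigenprojection J * J = Complex.I • complexEigenprojection J := by
  rw [complexEigenprojection, smul_mul_assoc, add_mul, one_mul, smul_mul_assoc, hJ,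
    smul_comm Complex.I]
  congr 1
  rw [smul_add, smul_smul, mul_neg, Complex.I_mul_I, neg_neg, one_smul, smul_neg, neg_smul,
    neg_neg, add_comm]

end ComplexEigenprojection

theorem rangeDet_complexEigenprojection_exp {ι : Type*} [Fintype ι] [DecidableEq ι]
    (ρ : ℂ →ₐ[ℝ] Matrix ι ι ℂ) (l : ℂ) :
    rangeDet (complexEigenprojection (ρ Complex.I)) (ρ (Complex.exp l)) =
      Complex.exp (l * (complexEigenprojection (ρ Complex.I)).trace) := by
  have hJ : ρ Complex.I * ρ Complex.I = -1 := by rw [← map_mul, Complex.I_mul_I, map_neg, map_one]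
  have hmul (z : ℂ) : complexEigenprojection (ρ Complex.I) * ρ z =
      z • complexEigenprojection (ρ Complex.I) := by
    have hz : ρ z = z.re • 1 + z.im • ρ Complex.I := by
      rw [← map_one ρ, ← map_smul, ← map_smul, ← map_add]
      congr 1
      apply Complex.ext <;> simp
    rw [hz, mul_add, mul_smul_comm, mul_smul_comm, mul_one, complexEigenprojection_mul_self hJ,
      ← Complex.coe_smul, ← Complex.coe_smul, smul_smul, ← add_smul, Complex.re_add_im]
  rw [rangeDet, hmul]
  exact det_exp_smul_add_one_sub (isIdempotentElem_complexEigenprojection hJ) l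

theorem trace_complexEigenprojection_ne_zero {ι : Type*} [Fintype ι] [DecidableEq ι] [Nonempty ι]
    {J : Matrix ι ι ℂ} {r : ℝ} (hJ : J.trace = r) : (complexEigenprojection J).trace ≠ 0 := by
  rw [complexEigenprojection, Matrix.trace_smul, Matrix.trace_add, Matrix.trace_smul,
    Matrix.trace_one, hJ]
  refine smul_ne_zero (by norm_num) fun h => ?_
  simpa using congrArg Complex.re h

/-! ### Hermitian matrices of skew-symmetric forms -/

section HermitianMatrix

open scoped ComplexOrder in
theorem posSemidef_map_algebraMap {ι : Type*} [Finite ι] {S : Matrix ι ι ℝ}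
    (hS : S.PosSemidef) : (S.map (algebraMap ℝ ℂ)).PosSemidef := by
  classical
  have := Fintype.ofFinite ι
  obtain ⟨C, rfl⟩ : ∃ C : Matrix ι ι ℝ, S = C.conjTranspose * C := by
    open scoped MatrixOrder in
    exact CStarAlgebra.nonneg_iff_eq_star_mul_self.1 (Matrix.nonneg_iff_posSemidef.2 hS)
  rw [Matrix.map_mul, Matrix.conjTranspose_map _ fun _ => by simp]
  exact Matrix.posSemidef_conjTranspose_mul_self _

variable {ι : Type*} [Fintype ι] [DecidableEq ι]
  {V : Type*} [AddCommGroup V] [Module ℝ V] (b : Module.Basis ι ℝ V)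

/-- The complexification of an endomorphism of a real vector space, as a matrix. -/
def complexMatrix : Module.End ℝ V →ₐ[ℝ] Matrix ι ι ℂ :=
  Complex.ofRealAm.mapMatrix.comp (LinearMap.toMatrixAlgEquiv b).toAlgHom

theorem complexMatrix_apply (f : Module.End ℝ V) :
    complexMatrix b f = (LinearMap.toMatrix b b f).map (algebraMap ℝ ℂ) := rfl

theorem trace_complexMatrix (f : Module.End ℝ V) :
    (complexMatrix b f).trace = (LinearMap.trace ℝ V f : ℂ) := by
  rw [LinearMap.trace_eq_matrix_trace ℝ b, complexMatrix_apply, ← Complex.coe_algebraMap,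
    AddMonoidHom.map_trace (algebraMap ℝ ℂ)]

/-- The Hermitian matrix `iB` of a skew-symmetric bilinear form `B`. -/
def hermitianMatrix (B : LinearMap.BilinForm ℝ V) : Matrix ι ι ℂ :=
  Complex.I • (LinearMap.BilinForm.toMatrix b B).map (algebraMap ℝ ℂ)

theorem isHermitian_hermitianMatrix {B : LinearMap.BilinForm ℝ V} (hB : ∀ x y, B x y = -B y x) :
    (hermitianMatrix b B).IsHermitian := by
  ext i j
  simp [hermitianMatrix, hB (b j) (b i)]

theorem isUnit_map_algebraMap {A : Matrix ι ι ℝ} (hA : A.det ≠ 0) :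
    IsUnit (A.map (algebraMap ℝ ℂ)) :=
  ((Matrix.isUnit_iff_isUnit_det A).2 hA.isUnit).map (algebraMap ℝ ℂ).mapMatrix

theorem isUnit_hermitianMatrix {B : LinearMap.BilinForm ℝ V} (hB : B.Nondegenerate) :
    IsUnit (hermitianMatrix b B) :=
  (isUnit_map_algebraMap ((LinearMap.BilinForm.nondegenerate_iff_det_ne_zero b).1 hB)).smul
    (Units.mk0 _ Complex.I_ne_zero)

variable {B : LinearMap.BilinForm ℝ V} {J : Module.End ℝ V}

theorem posDef_toMatrix_mul_toMatrix (hskew : ∀ x y, B x y = -B y x) (hJJ : J * J = -1)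
    (hBJ : ∀ x y, B (J x) (J y) = B x y) (hpos : ∀ x, x ≠ 0 → 0 < B x (J x)) :
    (LinearMap.BilinForm.toMatrix b B * LinearMap.toMatrix b b J).PosDef := by
  rw [← LinearMap.BilinForm.toMatrix_compRight]
  refine (LinearMap.BilinForm.posDef_toQuadraticMap_iff_matrix b _ ⟨fun x y => ?_⟩).1 hpos
  have hJJy : J (J y) = -y := LinearMap.congr_fun hJJ y
  rw [LinearMap.BilinForm.compRight_apply, LinearMap.BilinForm.compRight_apply, ← hBJ, hJJy,
    map_neg, ← hskew]

theorem commute_toMatrix (hJt : (LinearMap.toMatrix b b J).transpose = -LinearMap.toMatrix b b J)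
    (hJJ : J * J = -1) (hBJ : ∀ x y, B (J x) (J y) = B x y) :
    Commute (LinearMap.BilinForm.toMatrix b B) (LinearMap.toMatrix b b J) := by
  have hcomp : B.compLeft (-J) = B.compRight J := by
    ext x y
    have hJJx : J (-J x) = x := by
      rw [map_neg, neg_eq_iff_eq_neg]
      exact LinearMap.congr_fun hJJ x
    have h := hBJ (-J x) y
    rw [hJJx] at h
    exact h.symm
  have h := congrArg (LinearMap.BilinForm.toMatrix b) hcomp
  rw [LinearMap.BilinForm.toMatrix_compLeft, map_neg, Matrix.transpose_neg, hJt, neg_neg,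
    LinearMap.BilinForm.toMatrix_compRight] at h
  exact h.symm

open scoped Matrix.Norms.L2Operator MatrixOrder ComplexOrder in
theorem positiveProjection_hermitianMatrix
    (hJt : (LinearMap.toMatrix b b J).transpose = -LinearMap.toMatrix b b J)
    (hskew : ∀ x y, B x y = -B y x) (hJJ : J * J = -1)
    (hBJ : ∀ x y, B (J x) (J y) = B x y) (hpos : ∀ x, x ≠ 0 → 0 < B x (J x)) :
    positiveProjection (hermitianMatrix b B) =
      complexEigenprojection (complexMatrix b J) := by
  have hS := posDef_toMatrix_mul_toMatrix b hskew hJJ hBJ hpos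
  have hcomm := commute_toMatrix b hJt hJJ hBJ
  have hj : LinearMap.toMatrix b b J * LinearMap.toMatrix b b J = -1 := by
    rw [← LinearMap.toMatrix_mul, hJJ, map_neg, LinearMap.toMatrix_one]
  have hfactor : hermitianMatrix b B =
      (LinearMap.BilinForm.toMatrix b B * LinearMap.toMatrix b b J).map (algebraMap ℝ ℂ) *
        ((-Complex.I) • complexMatrix b J) := by
    rw [Matrix.mul_smul, complexMatrix_apply, ← Matrix.map_mul, mul_assoc, hj, mul_neg_one,
      Matrix.map_neg _ (map_neg _), smul_neg, neg_smul, neg_neg, hermitianMatrix]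
  have hself := isHermitian_hermitianMatrix b hskew
  rw [hfactor] at hself ⊢
  refine positiveProjection_mul ?_ ?_ ?_ ?_ hself
  · exact Matrix.nonneg_iff_posSemidef.2 (posSemidef_map_algebraMap hS.posSemidef)
  · exact isUnit_map_algebraMap hS.det_pos.ne'
  · refine Commute.smul_right ?_ _
    exact (hcomm.mul_left (Commute.refl _)).map (algebraMap ℝ ℂ).mapMatrix
  · exact neg_I_smul_mul_self (by rw [← map_mul, hJJ, map_neg, map_one])

end HermitianMatrix

/-! ### Stabilization of linear contact structures -/

theorem inner_map_map_of_skew {Q : Type*} [NormedAddCommGroup Q] [InnerProductSpace ℝ Q]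
    {J : Module.End ℝ Q} (hJ : ∀ x y, inner ℝ (J x) y = -inner ℝ x (J y)) (hJJ : J * J = -1)
    (x y : Q) : inner ℝ (J x) (J y) = inner ℝ x y := by
  rw [hJ, show J (J y) = -y from LinearMap.congr_fun hJJ y, inner_neg_right, neg_neg]

theorem transpose_toMatrix_of_skew {Q ι : Type*} [NormedAddCommGroup Q] [InnerProductSpace ℝ Q]
    [Fintype ι] [DecidableEq ι] (b : OrthonormalBasis ι ℝ Q) {J : Module.End ℝ Q}
    (hJ : ∀ x y, inner ℝ (J x) y = -inner ℝ x (J y)) :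
    (LinearMap.toMatrix b.toBasis b.toBasis J).transpose =
      -LinearMap.toMatrix b.toBasis b.toBasis J := by
  ext k l
  simp [LinearMap.toMatrix_apply, b.repr_apply_apply, real_inner_comm (J (b k)), hJ]

section StabilizedForm

variable {Q : Type*} [NormedAddCommGroup Q] [InnerProductSpace ℝ Q] [CompleteSpace Q]

/-- The unit vector normal to the kernel of a linear form, on its positive side. -/
def unitNormal (a : Q →L[ℝ] ℝ) : Q := ‖a‖⁻¹ • (InnerProductSpace.toDual ℝ Q).symm a

theorem inner_unitNormal (a : Q →L[ℝ] ℝ) (w : Q) : inner ℝ (unitNormal a) w = ‖a‖⁻¹ * a w := by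
  simp [unitNormal, real_inner_smul_left]

theorem norm_unitNormal {a : Q →L[ℝ] ℝ} (ha : a ≠ 0) : ‖unitNormal a‖ = 1 := by
  rw [unitNormal, norm_smul, LinearIsometryEquiv.norm_map, norm_inv, norm_norm,
    inv_mul_cancel₀ (norm_ne_zero_iff.2 ha)]

theorem unitNormal_smul {c : ℝ} (hc : 0 < c) (a : Q →L[ℝ] ℝ) :
    unitNormal (c • a) = unitNormal a := by
  rw [unitNormal, norm_smul, Real.norm_of_nonneg hc.le, unitNormal,
    map_smul (InnerProductSpace.toDual ℝ Q).symm c a]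
  simp [smul_smul, hc.ne']

theorem continuous_unitNormal {X : Type*} [TopologicalSpace X] {a : X → Q →L[ℝ] ℝ}
    (ha : Continuous a) (h0 : ∀ x, a x ≠ 0) : Continuous fun x => unitNormal (a x) :=
  (ha.norm.inv₀ fun x => norm_ne_zero_iff.2 (h0 x)).smul
    ((LinearIsometryEquiv.continuous _).comp ha)

/-- The projection of `Q` along `e` and the unit normal of `a`; it is orthogonal, onto
`e^⊥ ∩ ker a`, when `e` is a unit vector in `ker a`. -/
def coreProjection (e : Q) (a : Q →L[ℝ] ℝ) : Q →L[ℝ] Q :=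
  ContinuousLinearMap.id ℝ Q - (innerSL ℝ e).smulRight e -
    (innerSL ℝ (unitNormal a)).smulRight (unitNormal a)

theorem coreProjection_apply (e : Q) (a : Q →L[ℝ] ℝ) (w : Q) :
    coreProjection e a w = w - inner ℝ e w • e - inner ℝ (unitNormal a) w • unitNormal a := rfl

theorem coreProjection_eq_self {e : Q} {a : Q →L[ℝ] ℝ} {w : Q} (he : inner ℝ e w = 0)
    (ha : inner ℝ (unitNormal a) w = 0) : coreProjection e a w = w := by
  simp [coreProjection_apply, he, ha]

theorem inner_coreProjection_left {e : Q} (he : ‖e‖ = 1) {a : Q →L[ℝ] ℝ} (hae : a e = 0) (w : Q) :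
    inner ℝ e (coreProjection e a w) = 0 := by
  simp [coreProjection_apply, inner_sub_right, real_inner_smul_right, he,
    real_inner_comm (unitNormal a) e, inner_unitNormal, hae]

theorem inner_unitNormal_coreProjection (e : Q) {a : Q →L[ℝ] ℝ} (ha : a ≠ 0) (hae : a e = 0)
    (w : Q) : inner ℝ (unitNormal a) (coreProjection e a w) = 0 := by
  simp [coreProjection_apply, inner_sub_right, real_inner_smul_right, norm_unitNormal ha,
    inner_unitNormal a e, hae]

theorem map_coreProjection (e : Q) {a : Q →L[ℝ] ℝ} (ha : a ≠ 0) (hae : a e = 0) (w : Q) :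
    a (coreProjection e a w) = 0 := by
  have h := inner_unitNormal_coreProjection e ha hae w
  rw [inner_unitNormal] at h
  exact (mul_eq_zero.1 h).resolve_left (inv_ne_zero (norm_ne_zero_iff.2 ha))

/-- The form `Ω + e^* ∧ a` on `Q`, normalized so as to depend only on the hyperplane `ker a`, its
coorientation, and the conformal class of `Ω` on it. -/
def stabilizedForm (e : Q) (a : Q →L[ℝ] ℝ) (Ω : Q →L[ℝ] Q →L[ℝ] ℝ) : Q →L[ℝ] Q →L[ℝ] ℝ :=
  ‖a‖⁻¹ • Ω.bilinearComp (coreProjection e a) (coreProjection e a) +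
    ((innerSL ℝ e).smulRight (innerSL ℝ (unitNormal a)) -
      (innerSL ℝ (unitNormal a)).smulRight (innerSL ℝ e))

theorem stabilizedForm_apply (e : Q) (a : Q →L[ℝ] ℝ) (Ω : Q →L[ℝ] Q →L[ℝ] ℝ) (w w' : Q) :
    stabilizedForm e a Ω w w' =
      ‖a‖⁻¹ * Ω (coreProjection e a w) (coreProjection e a w') +
        (inner ℝ e w * inner ℝ (unitNormal a) w' - inner ℝ (unitNormal a) w * inner ℝ e w') := rfl

theorem stabilizedForm_swap (e : Q) (a : Q →L[ℝ] ℝ) {Ω : Q →L[ℝ] Q →L[ℝ] ℝ}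
    (hΩ : ∀ u v, Ω u v = -Ω v u) (w w' : Q) :
    stabilizedForm e a Ω w w' = -stabilizedForm e a Ω w' w := by
  rw [stabilizedForm_apply, stabilizedForm_apply, hΩ]
  ring

theorem stabilizedForm_congr {e : Q} {a : Q →L[ℝ] ℝ} (ha : a ≠ 0) (hae : a e = 0)
    {Ω Ω' : Q →L[ℝ] Q →L[ℝ] ℝ} {c : ℝ} (hc : 0 < c)
    (hΩ : ∀ u v, a u = 0 → a v = 0 → Ω' u v = c * Ω u v) :
    stabilizedForm e (c • a) Ω' = stabilizedForm e a Ω := by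
  have hcore : coreProjection e (c • a) = coreProjection e a := by
    rw [coreProjection, unitNormal_smul hc, coreProjection]
  ext w w'
  rw [stabilizedForm_apply, stabilizedForm_apply, unitNormal_smul hc, hcore,
    hΩ _ _ (map_coreProjection e ha hae w) (map_coreProjection e ha hae w'), norm_smul,
    Real.norm_of_nonneg hc.le, mul_inv_rev, ← mul_assoc, inv_mul_cancel_right₀ hc.ne']

theorem eq_zero_of_stabilizedForm_eq_zero {e : Q} (he : ‖e‖ = 1) {a : Q →L[ℝ] ℝ} (ha : a ≠ 0)
    (hae : a e = 0) {Ω : Q →L[ℝ] Q →L[ℝ] ℝ}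
    (hΩ : ∀ u, inner ℝ e u = 0 → a u = 0 → (∀ v, inner ℝ e v = 0 → a v = 0 → Ω u v = 0) → u = 0)
    {w : Q} (hw : ∀ w', stabilizedForm e a Ω w w' = 0) : w = 0 := by
  have hνe : inner ℝ (unitNormal a) e = 0 := by rw [inner_unitNormal, hae, mul_zero]
  have hν0 (u : Q) : inner ℝ (unitNormal a) u = 0 ↔ a u = 0 := by
    simp [inner_unitNormal, ha]
  have hcore_e : coreProjection e a e = 0 := by simp [coreProjection_apply, he, hνe]
  have hcore_ν : coreProjection e a (unitNormal a) = 0 := by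
    simp [coreProjection_apply, real_inner_comm (unitNormal a) e, hνe, norm_unitNormal ha]
  have hwν : inner ℝ (unitNormal a) w = 0 := by
    simpa [stabilizedForm_apply, hcore_e, hνe, he] using hw e
  have hwe : inner ℝ e w = 0 := by
    simpa [stabilizedForm_apply, hcore_ν, hwν, norm_unitNormal ha] using hw (unitNormal a)
  refine hΩ w hwe ((hν0 w).1 hwν) fun v hve hva => ?_
  simpa [stabilizedForm_apply, coreProjection_eq_self hwe hwν,
    coreProjection_eq_self hve ((hν0 v).2 hva), hwe, hwν, ha] using hw v

theorem continuous_stabilizedForm_apply {X : Type*} [TopologicalSpace X] (e : Q)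
    {a : X → Q →L[ℝ] ℝ} {Ω : X → Q →L[ℝ] Q →L[ℝ] ℝ} (ha : Continuous a) (hΩ : Continuous Ω)
    (h0 : ∀ x, a x ≠ 0) (w w' : Q) : Continuous fun x => stabilizedForm e (a x) (Ω x) w w' := by
  have hi : Continuous fun x => ‖a x‖⁻¹ := ha.norm.inv₀ fun x => norm_ne_zero_iff.2 (h0 x)
  have hν := continuous_unitNormal ha h0
  have hcore (w : Q) : Continuous fun x => coreProjection e (a x) w := by
    simp only [coreProjection_apply]
    fun_prop
  have := hcore w
  have := hcore w'
  simp only [stabilizedForm_apply]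
  fun_prop

section Compatible

variable {e : Q} {a : Q →L[ℝ] ℝ} {Ω : Q →L[ℝ] Q →L[ℝ] ℝ} {J : Module.End ℝ Q}

/-- `J` rotates the plane spanned by `e` and `J e`, and so commutes with the projection along it. -/
theorem coreProjection_map (hJ : ∀ x y, inner ℝ (J x) y = -inner ℝ x (J y))
    (hJJ : J * J = -1) (hν : unitNormal a = J e) (w : Q) :
    coreProjection e a (J w) = J (coreProjection e a w) := by
  have hJJe : J (J e) = -e := LinearMap.congr_fun hJJ e
  have he : inner ℝ e (J w) = -inner ℝ (J e) w := by rw [hJ, neg_neg]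
  simp only [coreProjection_apply, hν, he, inner_map_map_of_skew hJ hJJ, map_sub, map_smul, hJJe]
  module

theorem stabilizedForm_map_map (he : ‖e‖ = 1) (ha : a ≠ 0) (hae : a e = 0)
    (hJ : ∀ x y, inner ℝ (J x) y = -inner ℝ x (J y)) (hJJ : J * J = -1)
    (hν : unitNormal a = J e)
    (hΩ : ∀ u v, inner ℝ e u = 0 → a u = 0 → inner ℝ e v = 0 → a v = 0 →
      Ω (J u) (J v) = Ω u v) (w w' : Q) :
    stabilizedForm e a Ω (J w) (J w') = stabilizedForm e a Ω w w' := by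
  have he' (x : Q) : inner ℝ e (J x) = -inner ℝ (J e) x := by rw [hJ, neg_neg]
  rw [stabilizedForm_apply, stabilizedForm_apply, coreProjection_map hJ hJJ hν,
    coreProjection_map hJ hJJ hν, hν, inner_map_map_of_skew hJ hJJ,
    inner_map_map_of_skew hJ hJJ, he', he',
    hΩ _ _ (inner_coreProjection_left he hae w) (map_coreProjection e ha hae w)
      (inner_coreProjection_left he hae w') (map_coreProjection e ha hae w')]
  ring

theorem stabilizedForm_pos (he : ‖e‖ = 1) (ha : a ≠ 0) (hae : a e = 0)
    (hJ : ∀ x y, inner ℝ (J x) y = -inner ℝ x (J y)) (hJJ : J * J = -1)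
    (hν : unitNormal a = J e)
    (hΩ : ∀ u, inner ℝ e u = 0 → a u = 0 → u ≠ 0 → 0 < Ω u (J u)) {w : Q} (hw : w ≠ 0) :
    0 < stabilizedForm e a Ω w (J w) := by
  have hformula : stabilizedForm e a Ω w (J w) =
      ‖a‖⁻¹ * Ω (coreProjection e a w) (J (coreProjection e a w)) +
        (inner ℝ e w ^ 2 + inner ℝ (J e) w ^ 2) := by
    have he' : inner ℝ e (J w) = -inner ℝ (J e) w := by rw [hJ, neg_neg]
    rw [stabilizedForm_apply, coreProjection_map hJ hJJ hν, hν,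
      inner_map_map_of_skew hJ hJJ, he']
    ring
  rw [hformula]
  by_cases hcore : coreProjection e a w = 0
  · have hplane : inner ℝ e w ≠ 0 ∨ inner ℝ (J e) w ≠ 0 := by
      by_contra! h
      exact hw ((coreProjection_eq_self h.1 (hν ▸ h.2)).symm.trans hcore)
    rw [hcore, map_zero, map_zero, zero_apply, mul_zero, zero_add]
    rcases hplane with h | h <;> positivity
  · have hpos := hΩ _ (inner_coreProjection_left he hae w) (map_coreProjection e ha hae w) hcore
    have : 0 < ‖a‖ := norm_pos_iff.2 ha
    positivity

end Compatible

end StabilizedForm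

theorem continuous_flip {V W : Type*} [NormedAddCommGroup V] [NormedSpace ℝ V]
    [NormedAddCommGroup W] [NormedSpace ℝ W] :
    Continuous fun L : V →L[ℝ] W →L[ℝ] ℝ => L.flip :=
  (ContinuousLinearMap.flipₗᵢ ℝ V W ℝ).continuous

section Antisymmetrize

variable {V : Type*} [NormedAddCommGroup V] [NormedSpace ℝ V]

/-- The skew form `L(u, v) - L(v, u)`. It turns the derivative of a 1-form into its exterior
derivative. -/
def antisymmetrize (L : V →L[ℝ] V →L[ℝ] ℝ) : V →L[ℝ] V →L[ℝ] ℝ := L - L.flip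

theorem antisymmetrize_apply (L : V →L[ℝ] V →L[ℝ] ℝ) (u v : V) :
    antisymmetrize L u v = L u v - L v u :=
  rfl

theorem continuous_antisymmetrize :
    Continuous (antisymmetrize : (V →L[ℝ] V →L[ℝ] ℝ) → V →L[ℝ] V →L[ℝ] ℝ) := by
  -- Instance search times out on these two when the scope `UniformConvergence` is open.
  have : ContinuousSub (V →L[ℝ] V →L[ℝ] ℝ) :=
    ContinuousLinearMap.topologicalAddGroup.to_continuousSub
  let : Sub (V →L[ℝ] V →L[ℝ] ℝ) := ContinuousLinearMap.sub
  exact continuous_id.sub continuous_flip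

end Antisymmetrize

/-- A Euclidean space `Q` presented as `V ⊕ ℝe` for a unit vector `e`. It provides an auxiliary
inner product and the extra dimension in which a contact structure becomes a symplectic one. -/
structure Stabilization (V Q : Type*) [NormedAddCommGroup V] [NormedSpace ℝ V]
    [NormedAddCommGroup Q] [InnerProductSpace ℝ Q] where
  e : Q
  pr : Q →L[ℝ] V
  norm_e : ‖e‖ = 1
  ker_pr : LinearMap.ker (pr : Q →ₗ[ℝ] V) = ℝ ∙ e
  surjective_pr : Function.Surjective pr

namespace Stabilization

variable {V Q : Type*} [NormedAddCommGroup V] [NormedSpace ℝ V] [NormedAddCommGroup Q]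
  [InnerProductSpace ℝ Q] (D : Stabilization V Q)

theorem pr_e : D.pr D.e = 0 := by
  have h : D.e ∈ LinearMap.ker (D.pr : Q →ₗ[ℝ] V) := D.ker_pr ▸ Submodule.mem_span_singleton_self _
  exact h

theorem comp_pr_e (a : V →L[ℝ] ℝ) : a.comp D.pr D.e = 0 :=
  (congrArg a D.pr_e).trans (map_zero a)

theorem comp_pr_ne_zero {a : V →L[ℝ] ℝ} (ha : a ≠ 0) : a.comp D.pr ≠ 0 := by
  obtain ⟨v, hv⟩ := DFunLike.exists_ne ha
  obtain ⟨w, rfl⟩ := D.surjective_pr v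
  exact fun h => hv (DFunLike.congr_fun h w)

theorem exists_inner_e_eq_zero (v : V) : ∃ w, inner ℝ D.e w = 0 ∧ D.pr w = v := by
  obtain ⟨w, rfl⟩ := D.surjective_pr v
  exact ⟨w - inner ℝ D.e w • D.e, by simp [inner_sub_right, real_inner_smul_right, D.norm_e],
    by simp [D.pr_e]⟩

theorem eq_zero_of_pr_eq_zero {w : Q} (he : inner ℝ D.e w = 0) (hw : D.pr w = 0) : w = 0 := by
  have hker : w ∈ LinearMap.ker (D.pr : Q →ₗ[ℝ] V) := hw
  rw [D.ker_pr] at hker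
  obtain ⟨c, rfl⟩ := Submodule.mem_span_singleton.1 hker
  rw [real_inner_smul_right, real_inner_self_eq_norm_sq, D.norm_e, one_pow, mul_one] at he
  rw [he, zero_smul]

variable [CompleteSpace Q]

/-- The stabilization `Ω + e^* ∧ a` of a linear contact structure `(a, Ω)` on `V`. -/
def form (a : V →L[ℝ] ℝ) (Ω : V →L[ℝ] V →L[ℝ] ℝ) : Q →L[ℝ] Q →L[ℝ] ℝ :=
  stabilizedForm D.e (a.comp D.pr) (Ω.bilinearComp D.pr D.pr)

theorem form_swap (a : V →L[ℝ] ℝ) {Ω : V →L[ℝ] V →L[ℝ] ℝ} (hΩ : ∀ u v, Ω u v = -Ω v u)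
    (w w' : Q) : D.form a Ω w w' = -D.form a Ω w' w :=
  stabilizedForm_swap _ _ (fun _ _ => hΩ _ _) w w'

theorem form_congr {a : V →L[ℝ] ℝ} (ha : a ≠ 0) {Ω Ω' : V →L[ℝ] V →L[ℝ] ℝ} {c : ℝ} (hc : 0 < c)
    (hΩ : ∀ u v, a u = 0 → a v = 0 → Ω' u v = c * Ω u v) :
    D.form (c • a) Ω' = D.form a Ω :=
  stabilizedForm_congr (D.comp_pr_ne_zero ha) (D.comp_pr_e a) hc fun _ _ => hΩ _ _

theorem form_nondegenerate {a : V →L[ℝ] ℝ} (ha : a ≠ 0) {Ω : V →L[ℝ] V →L[ℝ] ℝ}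
    (hskew : ∀ u v, Ω u v = -Ω v u)
    (hΩ : ∀ u, a u = 0 → (∀ v, a v = 0 → Ω u v = 0) → u = 0) :
    (D.form a Ω).toBilinForm.Nondegenerate := by
  have hleft (w : Q) (hw : ∀ w', D.form a Ω w w' = 0) : w = 0 := by
    refine eq_zero_of_stabilizedForm_eq_zero D.norm_e (D.comp_pr_ne_zero ha) (D.comp_pr_e a)
      (fun u hu hau h => D.eq_zero_of_pr_eq_zero hu (hΩ _ hau fun v hv => ?_)) hw
    obtain ⟨v, hve, rfl⟩ := D.exists_inner_e_eq_zero v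
    exact h v hve hv
  exact ⟨hleft, fun w hw => hleft w fun w' => by
    rw [D.form_swap a hskew, show D.form a Ω w' w = 0 from hw w', neg_zero]⟩

theorem continuous_form_apply {X : Type*} [TopologicalSpace X] {a : X → V →L[ℝ] ℝ}
    {Ω : X → V →L[ℝ] V →L[ℝ] ℝ} (ha : Continuous a) (hΩ : Continuous Ω) (h0 : ∀ x, a x ≠ 0)
    (w w' : Q) : Continuous fun x => D.form (a x) (Ω x) w w' := by
  have hΩ' : Continuous fun x => (Ω x).bilinearComp D.pr D.pr :=
    continuous_flip.comp
      ((continuous_flip.comp (hΩ.clm_comp continuous_const)).clm_comp continuous_const)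
  exact continuous_stabilizedForm_apply D.e (ha.clm_comp continuous_const) hΩ'
    (fun x => D.comp_pr_ne_zero (h0 x)) w w'

end Stabilization

/-! ### The 1-jet of a contact form at a point -/

theorem differentiableAt_of_differentiableAt_smul {𝕜 E F : Type*} [NontriviallyNormedField 𝕜]
    [NormedAddCommGroup E] [NormedSpace 𝕜 E] [NormedAddCommGroup F] [NormedSpace 𝕜 F]
    [SeparatingDual 𝕜 F] {k : E → 𝕜} {f : E → F} {x : E} (hf : DifferentiableAt 𝕜 f x)
    (hkf : DifferentiableAt 𝕜 (fun y => k y • f y) x) (h0 : f x ≠ 0) :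
    DifferentiableAt 𝕜 k x := by
  obtain ⟨l, hl⟩ := SeparatingDual.exists_ne_zero (R := 𝕜) h0
  have hlf : DifferentiableAt 𝕜 (fun y => l (f y)) x := l.differentiableAt.comp x hf
  have hlkf : DifferentiableAt 𝕜 (fun y => l (k y • f y)) x := l.differentiableAt.comp x hkf
  refine (hlkf.fun_mul (hlf.fun_inv hl)).congr_of_eventuallyEq ?_
  filter_upwards [hlf.continuousAt.eventually_ne hl] with y hy
  rw [map_smul, smul_eq_mul, mul_inv_cancel_right₀ hy]

namespace ContactForm

variable {m : ℕ} {M : Type*} [TopologicalSpace M] [ChartedSpace (Model m) M]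
  [IsManifold (𝓡 (2 * m + 1)) ∞ M]

theorem continuous_iteratedFDeriv_localForm (q : M) (k : ℕ) :
    Continuous fun α : ContactForm m M => iteratedFDeriv ℝ k (localForm α.toFun q)
      (extChartAt (𝓡 (2 * m + 1)) q q) := by
  have hjet : Continuous (fun α : ContactForm m M => UniformOnFun.ofFun
      {K : Set (Model m) | IsCompact K ∧ K ⊆ (extChartAt (𝓡 (2 * m + 1)) q).target}
      (iteratedFDeriv ℝ k (localForm α.toFun q))) :=
    continuous_iff_le_induced.2 ((iInf_le _ q).trans (iInf_le _ k))
  exact (UniformOnFun.uniformContinuous_eval_of_mem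
    (β := ContinuousMultilinearMap ℝ (fun _ : Fin k => Model m) (Model m →L[ℝ] ℝ))
    {K : Set (Model m) | IsCompact K ∧ K ⊆ (extChartAt (𝓡 (2 * m + 1)) q).target}
    (x := extChartAt (𝓡 (2 * m + 1)) q q) (Set.mem_singleton _)
    ⟨isCompact_singleton, by simp⟩).continuous.comp hjet

theorem continuous_localForm (q : M) :
    Continuous fun α : ContactForm m M =>
      localForm α.toFun q (extChartAt (𝓡 (2 * m + 1)) q q) := by
  have h : (fun α : ContactForm m M => localForm α.toFun q (extChartAt (𝓡 (2 * m + 1)) q q)) =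
      fun α : ContactForm m M => continuousMultilinearCurryFin0 ℝ (Model m) (Model m →L[ℝ] ℝ)
        (iteratedFDeriv ℝ 0 (localForm α.toFun q) (extChartAt (𝓡 (2 * m + 1)) q q)) := by
    ext1 α
    simp [iteratedFDeriv_zero_eq_comp]
  rw [h]
  exact (LinearIsometryEquiv.continuous _).comp (continuous_iteratedFDeriv_localForm q 0)

theorem continuous_fderiv_localForm (q : M) :
    Continuous fun α : ContactForm m M =>
      fderiv ℝ (localForm α.toFun q) (extChartAt (𝓡 (2 * m + 1)) q q) := by
  have h : (fun α : ContactForm m M => fderiv ℝ (localForm α.toFun q)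
        (extChartAt (𝓡 (2 * m + 1)) q q)) =
      fun α : ContactForm m M => continuousMultilinearCurryFin1 ℝ (Model m) (Model m →L[ℝ] ℝ)
        (iteratedFDeriv ℝ 1 (localForm α.toFun q) (extChartAt (𝓡 (2 * m + 1)) q q)) := by
    ext1 α
    ext v
    simp [iteratedFDeriv_one_apply]
  rw [h]
  exact (LinearIsometryEquiv.continuous _).comp (continuous_iteratedFDeriv_localForm q 1)

theorem localForm_extChartAt_apply (α : ContactForm m M) (q : M) (v : Model m) :
    localForm α.toFun q (extChartAt (𝓡 (2 * m + 1)) q q) v = α.toFun q v := by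
  have : IsManifold (𝓡 (2 * m + 1)) 1 M := IsManifold.of_le (n := ∞) (by simp)
  have hchart : mfderiv 𝓘(ℝ, Model m) (𝓡 (2 * m + 1)) (extChartAt (𝓡 (2 * m + 1)) q).symm
      (extChartAt (𝓡 (2 * m + 1)) q q) v = v := by
    have h : mfderivWithin 𝓘(ℝ, Model m) (𝓡 (2 * m + 1)) (extChartAt (𝓡 (2 * m + 1)) q).symm
        (Set.range (𝓡 (2 * m + 1))) (extChartAt (𝓡 (2 * m + 1)) q q) =
        ContinuousLinearMap.id ℝ _ := mfderivWithin_range_extChartAt_symm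
    rw [ModelWithCorners.range_eq_univ, mfderivWithin_univ] at h
    exact DFunLike.congr_fun h v
  have hbase (x : M) (hx : x = q) (w : Model m) : α.toFun x w = α.toFun q w := by
    subst hx
    rfl
  rw [localForm]
  exact (hbase _ (extChartAt_to_inv q) _).trans (congrArg (α.toFun q) hchart)

theorem differentiableAt_localForm (α : ContactForm m M) (q : M) :
    DifferentiableAt ℝ (localForm α.toFun q) (extChartAt (𝓡 (2 * m + 1)) q q) := by
  have : IsManifold (𝓡 (2 * m + 1)) 1 M := IsManifold.of_le (n := ∞) (by simp)
  have h := ((contMDiffAt_hom_bundle (E₁ := (TangentSpace (𝓡 (2 * m + 1)) : M → Type _))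
    (E₂ := Bundle.Trivial M ℝ) _).1 (α.smooth.contMDiffAt (x := q))).2
  rw [contMDiffAt_iff_source, ModelWithCorners.range_eq_univ, contMDiffWithinAt_univ,
    contMDiffAt_iff_contDiffAt] at h
  refine (h.differentiableAt (by simp)).congr_of_eventuallyEq ?_
  filter_upwards [(extChartAt_target_mem_nhds q :
    (extChartAt (𝓡 (2 * m + 1)) q).target ∈ _)] with y hy
  have hsource : (extChartAt (𝓡 (2 * m + 1)) q).symm y ∈ (chartAt (Model m) q).source := by
    simpa only [extChartAt_source] using (extChartAt (𝓡 (2 * m + 1)) q).map_target hy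
  have htriv : (trivializationAt (Model m) (TangentSpace (𝓡 (2 * m + 1))) q).symmL ℝ
      ((extChartAt (𝓡 (2 * m + 1)) q).symm y) = _ := TangentBundle.symmL_trivializationAt hsource
  rw [ModelWithCorners.range_eq_univ, mfderivWithin_univ,
    (extChartAt (𝓡 (2 * m + 1)) q).right_inv hy] at htriv
  ext v
  simp only [localForm, Function.comp_apply, ContinuousLinearMap.inCoordinates]
  erw [htriv]
  simp

/-- The value of a contact form at `q`, as a linear form on the model space. -/
def formAt (α : ContactForm m M) (q : M) : Model m →L[ℝ] ℝ := α.toFun q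

theorem localForm_extChartAt (α : ContactForm m M) (q : M) :
    localForm α.toFun q (extChartAt (𝓡 (2 * m + 1)) q q) = formAt α q :=
  ContinuousLinearMap.ext (localForm_extChartAt_apply α q)

theorem continuous_formAt (q : M) : Continuous fun α : ContactForm m M => formAt α q := by
  simpa only [localForm_extChartAt] using continuous_localForm (m := m) q

theorem formAt_ne_zero (α : ContactForm m M) (q : M) : formAt α q ≠ 0 := by
  obtain ⟨v, hv⟩ := α.contact q
  exact fun h => hv (by simp [wedgePow, show α.toFun q = 0 from h])

/-- The exterior derivative of a contact form at `q`, as a bilinear form on the model space. -/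
def dFormAt (α : ContactForm m M) (q : M) : Model m →L[ℝ] Model m →L[ℝ] ℝ :=
  antisymmetrize (fderiv ℝ (localForm α.toFun q) (extChartAt (𝓡 (2 * m + 1)) q q))

theorem dFormAt_apply (α : ContactForm m M) (q : M) (u v : Model m) :
    dFormAt α q u v = dForm α.toFun q u v := by
  have : IsManifold (𝓡 (2 * m + 1)) 1 M := IsManifold.of_le (n := ∞) (by simp)
  have h (v : Model m) : mfderiv (𝓡 (2 * m + 1)) 𝓘(ℝ, Model m)
      (extChartAt (𝓡 (2 * m + 1)) q) q v = v :=
    DFunLike.congr_fun (show mfderiv (𝓡 (2 * m + 1)) 𝓘(ℝ, Model m)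
      (extChartAt (𝓡 (2 * m + 1)) q) q = ContinuousLinearMap.id ℝ _ from
        mfderiv_extChartAt_self) v
  simp only [dForm]
  rw [h, h]
  rfl

theorem continuous_dFormAt (q : M) : Continuous fun α : ContactForm m M => dFormAt α q :=
  continuous_antisymmetrize.comp (continuous_fderiv_localForm q)

theorem dFormAt_swap (α : ContactForm m M) (q : M) (u v : Model m) :
    dFormAt α q u v = -dFormAt α q v u :=
  (neg_sub _ _).symm

theorem dFormAt_nondegenerate (α : ContactForm m M) (q : M) (u : Model m) (hu : formAt α q u = 0)
    (h : ∀ v, formAt α q v = 0 → dFormAt α q u v = 0) : u = 0 := by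
  obtain ⟨v, hv⟩ := α.contact q
  refine eq_zero_of_wedgePow_ne_zero (V := Model m) (m := m) (by simp)
    (a := (formAt α q : Model m →ₗ[ℝ] ℝ)) (Ω := (dFormAt α q).toBilinForm) (v := v) ?_ hu h
    (fun w hw => ?_)
  · have hdForm : (fun x y : Model m => dFormAt α q x y) = dForm α.toFun q :=
      funext fun x => funext (dFormAt_apply α q x)
    rw [← hdForm] at hv
    exact hv
  · rw [ContinuousLinearMap.toBilinForm_apply, dFormAt_swap, h w hw, neg_zero]

theorem exists_smul_of_equiv {α β : ContactForm m M} (h : α ≈ β) (q : M) :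
    ∃ c : ℝ, 0 < c ∧ formAt β q = c • formAt α q ∧
      ∀ u v, formAt α q u = 0 → formAt α q v = 0 → dFormAt β q u v = c * dFormAt α q u v := by
  choose c hc hβ using h
  set y₀ := extChartAt (𝓡 (2 * m + 1)) q q
  set k : Model m → ℝ := fun y => c ((extChartAt (𝓡 (2 * m + 1)) q).symm y)
  have hsmul : localForm β.toFun q = fun y => k y • localForm α.toFun q y := by
    ext1 y
    rw [localForm, localForm, hβ]
    rfl
  have hα := differentiableAt_localForm α q
  have hk : DifferentiableAt ℝ k y₀ :=
    differentiableAt_of_differentiableAt_smul hα (hsmul ▸ differentiableAt_localForm β q)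
      (localForm_extChartAt α q ▸ formAt_ne_zero α q)
  have hderiv : fderiv ℝ (localForm β.toFun q) y₀ =
      k y₀ • fderiv ℝ (localForm α.toFun q) y₀ + (fderiv ℝ k y₀).smulRight (formAt α q) := by
    rw [hsmul, fderiv_fun_smul hk hα, localForm_extChartAt]
  refine ⟨k y₀, hc _, ?_, fun u v hu hv => ?_⟩
  · rw [← localForm_extChartAt, ← localForm_extChartAt, hsmul]
  · have hβ' (u v : Model m) (hv : formAt α q v = 0) :
        fderiv ℝ (localForm β.toFun q) y₀ u v = k y₀ * fderiv ℝ (localForm α.toFun q) y₀ u v := by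
      simp [hderiv, hv]
    rw [dFormAt, dFormAt, antisymmetrize_apply, antisymmetrize_apply, hβ' u v hv, hβ' v u hu,
      mul_sub]

end ContactForm

/-! ### The projection attached to a contact structure at a point -/

section ContactProjection

open ContactForm
open scoped Matrix.Norms.L2Operator MatrixOrder ComplexOrder

variable {m : ℕ} {M : Type*} [TopologicalSpace M] [ChartedSpace (Model m) M]
  [IsManifold (𝓡 (2 * m + 1)) ∞ M] {Q : Type*} [NormedAddCommGroup Q] [InnerProductSpace ℝ Q]
  [CompleteSpace Q] {ι : Type*} [Fintype ι] [DecidableEq ι] (b : Module.Basis ι ℝ Q)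
  (D : Stabilization (Model m) Q) (q : M)

/-- The matrix in the basis `b` of the Hermitian form `iB`, where `B` is the symplectic form that
stabilizes a contact form at `q`. -/
def contactHermitian (α : ContactForm m M) : Matrix ι ι ℂ :=
  hermitianMatrix b (D.form (formAt α q) (dFormAt α q)).toBilinForm

theorem isSelfAdjoint_contactHermitian (α : ContactForm m M) :
    IsSelfAdjoint (contactHermitian b D q α) :=
  isHermitian_hermitianMatrix b (D.form_swap _ (dFormAt_swap α q))

theorem isUnit_contactHermitian (α : ContactForm m M) : IsUnit (contactHermitian b D q α) :=
  isUnit_hermitianMatrix b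
    (D.form_nondegenerate (formAt_ne_zero α q) (dFormAt_swap α q) (dFormAt_nondegenerate α q))

theorem continuous_contactHermitian :
    Continuous fun α : ContactForm m M => contactHermitian b D q α := by
  refine continuous_pi fun i => continuous_pi fun j => ?_
  have hform := D.continuous_form_apply (continuous_formAt (m := m) q) (continuous_dFormAt q)
    (fun α => formAt_ne_zero α q) (b i) (b j)
  simp only [contactHermitian, hermitianMatrix, Matrix.smul_apply, Matrix.map_apply,
    LinearMap.BilinForm.toMatrix_apply]
  exact (Complex.continuous_ofReal.comp hform).const_smul Complex.I

theorem contactHermitian_congr {α β : ContactForm m M} (h : α ≈ β) :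
    contactHermitian b D q α = contactHermitian b D q β := by
  obtain ⟨c, hc, hform, hdForm⟩ := exists_smul_of_equiv h q
  rw [contactHermitian, contactHermitian, hform, D.form_congr (formAt_ne_zero α q) hc hdForm]

/-- The spectral projection to the positive eigenspaces of the Hermitian form attached to a contact
structure at `q`. -/
def contactProjection (ξ : ContactStructure m M) : Matrix ι ι ℂ :=
  Quotient.lift (fun α => positiveProjection (contactHermitian b D q α))
    (fun _ _ h => congrArg positiveProjection (contactHermitian_congr b D q h)) ξ

theorem contactProjection_ker (α : ContactForm m M) :
    contactProjection b D q α.ker = positiveProjection (contactHermitian b D q α) := rfl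

theorem continuous_contactProjection :
    Continuous (contactProjection b D q : ContactStructure m M → Matrix ι ι ℂ) :=
  (continuous_positiveProjection (continuous_contactHermitian b D q)
    (isSelfAdjoint_contactHermitian b D q) (isUnit_contactHermitian b D q)).quotient_lift _

theorem isIdempotentElem_contactProjection (ξ : ContactStructure m M) :
    IsIdempotentElem (contactProjection b D q ξ) := by
  induction ξ using Quotient.inductionOn with
  | h α =>
    exact isIdempotentElem_positiveProjection (isSelfAdjoint_contactHermitian b D q α)
      (isUnit_contactHermitian b D q α)

end ContactProjection

/-! ### The winding of the linear quaternionic sphere -/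

/-- The quaternion `a + bi + cj + dk`, typed so that the coordinate lemmas of `ℍ[ℝ]` apply. -/
def quat (a b c d : ℝ) : ℍ[ℝ] := ⟨a, b, c, d⟩

@[simp] theorem quat_re (a b c d : ℝ) : (quat a b c d).re = a := rfl

@[simp] theorem quat_imI (a b c d : ℝ) : (quat a b c d).imI = b := rfl

@[simp] theorem quat_imJ (a b c d : ℝ) : (quat a b c d).imJ = c := rfl

@[simp] theorem quat_imK (a b c d : ℝ) : (quat a b c d).imK = d := rfl

theorem unitIm_eq_quat (z : S2) : unitIm z = quat 0 (z.1 0) (z.1 1) (z.1 2) := rfl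

theorem star_unitIm (z : S2) : star (unitIm z) = -unitIm z := by
  rw [unitIm_eq_quat]
  ext <;> simp

theorem unitIm_mul_self (z : S2) : unitIm z * unitIm z = -1 := by
  have hz := z.2
  rw [mem_sphere_zero_iff_norm, EuclideanSpace.norm_eq, Real.sqrt_eq_one,
    Fin.sum_univ_three] at hz
  simp only [Real.norm_eq_abs, sq_abs] at hz
  rw [unitIm_eq_quat]
  ext
  · simp only [Quaternion.re_mul, Quaternion.re_neg, Quaternion.re_one, quat_re, quat_imI, quat_imJ,
      quat_imK]
    linarith
  all_goals simp [mul_comm]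

section Rotor

/-- The embedding of `ℂ` in the quaternions that maps the imaginary unit to `k`. -/
def complexToQuaternion : ℂ →ₐ[ℝ] ℍ[ℝ] :=
  Complex.lift ⟨quat 0 0 0 1, by ext <;> simp⟩

theorem complexToQuaternion_apply (z : ℂ) : complexToQuaternion z = quat z.re 0 0 z.im := by
  ext <;> simp [complexToQuaternion, Complex.liftAux_apply]

theorem continuous_complexToQuaternion : Continuous complexToQuaternion :=
  complexToQuaternion.toLinearMap.continuous_of_finiteDimensional

theorem complexToQuaternion_ne_zero {z : ℂ} (hz : z ≠ 0) : complexToQuaternion z ≠ 0 :=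
  (map_ne_zero complexToQuaternion).2 hz

theorem unitIm_northPole : unitIm northPole = complexToQuaternion Complex.I := by
  ext <;> simp [unitIm_eq_quat, northPole, collapseVec, complexToQuaternion_apply]

/-- A quaternion that conjugates `k` to the point of `S²` with stereographic coordinates
`(x / w, y / w)`. -/
def rotor (x y w : ℝ) : ℍ[ℝ] := complexToQuaternion ⟨x, y⟩ + w • quat 0 0 1 0

theorem rotor_eq (x y w : ℝ) : rotor x y w = quat x 0 w y := by
  ext <;> simp [rotor, complexToQuaternion_apply]

theorem rotor_ne_zero {x y w : ℝ} (h : x ^ 2 + y ^ 2 + w ^ 2 ≠ 0) : rotor x y w ≠ 0 := by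
  contrapose! h
  rw [rotor_eq] at h
  have hx : x = 0 := congrArg QuaternionAlgebra.re h
  have hy : y = 0 := congrArg QuaternionAlgebra.imK h
  have hw : w = 0 := congrArg QuaternionAlgebra.imJ h
  rw [hx, hy, hw]
  norm_num

theorem semiconjBy_rotor {x y w : ℝ} (h : x ^ 2 + y ^ 2 + w ^ 2 ≠ 0) :
    SemiconjBy (rotor x y w) (complexToQuaternion Complex.I)
      (unitIm ⟨collapseVec x y w, collapseVec_mem h⟩) := by
  rw [SemiconjBy, rotor_eq, complexToQuaternion_apply, unitIm_eq_quat]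
  ext <;> simp [collapseVec] <;> field_simp <;> ring

/-- A nonvanishing function on the square `[-1, 1]²` that is equal to `x + iy` on the three sides
`x = ±1` and `y = -1`. -/
def sideExtension (x y : ℝ) : ℂ := x + (y * x ^ 2 - (1 - x ^ 2)) * Complex.I

theorem sideExtension_eq (x y : ℝ) : sideExtension x y = ⟨x, y * x ^ 2 - (1 - x ^ 2)⟩ := by
  apply Complex.ext <;> simp [sideExtension, ← Complex.ofReal_pow]

theorem sideExtension_ne_zero (x y : ℝ) : sideExtension x y ≠ 0 := by
  intro h
  rw [sideExtension_eq] at h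
  have hre : x = 0 := congrArg Complex.re h
  have him : y * x ^ 2 - (1 - x ^ 2) = 0 := congrArg Complex.im h
  norm_num [hre] at him

theorem sideExtension_of_side {x y : ℝ} (h : x ^ 2 = 1 ∨ y = -1) : sideExtension x y = ⟨x, y⟩ := by
  rw [sideExtension_eq]
  rcases h with h | rfl
  · simp [h]
  · congr 1
    ring

theorem I_mul_sideExtension (x : ℝ) : Complex.I * sideExtension x 1 = ⟨1 - 2 * x ^ 2, x⟩ := by
  rw [sideExtension_eq]
  apply Complex.ext <;> simp
  ring

/-- A continuous logarithm of `(x + i) / sideExtension x 1`. The rotation by `i` keeps the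
denominator off the branch cut. -/
def sideLog (x : ℝ) : ℂ :=
  Complex.log (x + Complex.I) - Complex.log (Complex.I * sideExtension x 1) + Complex.log Complex.I

theorem continuous_sideLog : Continuous sideLog := by
  unfold sideLog
  refine (Continuous.sub ?_ ?_).add continuous_const
  · exact Continuous.clog (by fun_prop) fun x => Or.inr (by simp)
  · refine Continuous.clog (by unfold sideExtension; fun_prop) fun x => ?_
    rw [I_mul_sideExtension]
    rcases eq_or_ne x 0 with rfl | hx
    · exact Or.inl (by simp)
    · exact Or.inr hx

theorem exp_sideLog (x : ℝ) : Complex.exp (sideLog x) = (x + Complex.I) / sideExtension x 1 := by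
  have hnum : (x : ℂ) + Complex.I ≠ 0 := fun h => by simpa using congrArg Complex.im h
  have hden := sideExtension_ne_zero x 1
  rw [sideLog, Complex.exp_add, Complex.exp_sub, Complex.exp_log hnum,
    Complex.exp_log (mul_ne_zero Complex.I_ne_zero hden), Complex.exp_log Complex.I_ne_zero]
  field_simp

theorem sideLog_one_sub_sideLog_neg_one_ne_zero : sideLog 1 - sideLog (-1) ≠ 0 := by
  have hone : Complex.I * sideExtension 1 1 = -1 + Complex.I := by
    rw [I_mul_sideExtension]
    apply Complex.ext <;> norm_num
  have hneg : Complex.I * sideExtension (-1) 1 = -1 - Complex.I := by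
    rw [I_mul_sideExtension]
    apply Complex.ext <;> norm_num
  have hfirst : Complex.arg (1 + Complex.I) ≤ Real.pi / 2 :=
    Complex.arg_le_pi_div_two_iff.2 (Or.inl (by simp))
  have hsecond : Real.pi / 2 < Complex.arg (-1 + Complex.I) :=
    lt_of_not_ge fun h => by norm_num [Complex.arg_le_pi_div_two_iff] at h
  have hthird : Complex.arg (-1 - Complex.I) < 0 := Complex.arg_neg_iff.2 (by simp)
  intro h
  have him := congrArg Complex.im h
  simp only [sideLog, hone, hneg, Complex.sub_im, Complex.add_im, Complex.log_im, Complex.zero_im,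
    Complex.ofReal_one, Complex.ofReal_neg] at him
  linarith [Real.pi_pos]

end Rotor

section Clutching

open scoped Matrix.Norms.L2Operator

/-- The affine coordinate on `[0, 1]` with values in `[-1, 1]`. -/
def centered (s : I) : ℝ := 2 * s - 1

theorem continuous_centered : Continuous centered := by
  unfold centered
  fun_prop

theorem centered_zero : centered 0 = -1 := by simp [centered]

theorem centered_one : centered 1 = 1 := by norm_num [centered]

/-- The third homogeneous stereographic coordinate of the point `collapse ![p.1, p.2]`. -/
def collapseHeight (p : I × I) : ℝ := (1 - centered p.1 ^ 2) * (1 - centered p.2 ^ 2)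

/-- The rotor of `collapse ![p.1, p.2]`, corrected by a complex factor, which commutes with `k`, so
that it is equal to `1` on three sides of the square. -/
def clutching (p : I × I) : ℍ[ℝ] :=
  rotor (centered p.1) (centered p.2) (collapseHeight p) *
    (complexToQuaternion (sideExtension (centered p.1) (centered p.2)))⁻¹

theorem continuous_clutching : Continuous clutching := by
  have hx : Continuous fun p : I × I => centered p.1 := continuous_centered.comp continuous_fst
  have hy : Continuous fun p : I × I => centered p.2 := continuous_centered.comp continuous_snd
  have hxy : Continuous fun p : I × I => (⟨centered p.1, centered p.2⟩ : ℂ) :=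
    Complex.equivRealProdCLM.symm.continuous.comp (hx.prodMk hy)
  have hside : Continuous fun p : I × I => sideExtension (centered p.1) (centered p.2) := by
    unfold sideExtension
    fun_prop
  have hrotor : Continuous fun p : I × I =>
      rotor (centered p.1) (centered p.2) (collapseHeight p) := by
    unfold rotor collapseHeight
    exact (continuous_complexToQuaternion.comp hxy).add (by fun_prop)
  exact hrotor.mul ((continuous_complexToQuaternion.comp hside).inv₀ fun p =>
    complexToQuaternion_ne_zero (sideExtension_ne_zero _ _))

theorem clutching_ne_zero (p : I × I) : clutching p ≠ 0 :=
  mul_ne_zero (rotor_ne_zero (collapse_ne _ _))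
    (inv_ne_zero (complexToQuaternion_ne_zero (sideExtension_ne_zero _ _)))

theorem semiconjBy_clutching (p : I × I) :
    SemiconjBy (clutching p) (complexToQuaternion Complex.I)
      (unitIm (collapse ![p.1, p.2])) := by
  refine SemiconjBy.mul_left (semiconjBy_rotor (collapse_ne _ _)) ?_
  rw [← map_inv₀]
  exact (Commute.all _ _).map complexToQuaternion

theorem clutching_of_collapseHeight_eq_zero {p : I × I} (h : collapseHeight p = 0) :
    clutching p = complexToQuaternion
      (⟨centered p.1, centered p.2⟩ / sideExtension (centered p.1) (centered p.2)) := by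
  rw [clutching, rotor, h, zero_smul, add_zero, map_div₀, div_eq_mul_inv]

theorem clutching_of_side {p : I × I} (h : centered p.1 ^ 2 = 1 ∨ centered p.2 = -1) :
    clutching p = 1 := by
  have hheight : collapseHeight p = 0 := by
    rcases h with h | h <;> simp [collapseHeight, h]
  have hdiv := div_self (sideExtension_ne_zero (centered p.1) (centered p.2))
  rw [clutching_of_collapseHeight_eq_zero hheight, ← sideExtension_of_side h, hdiv, map_one]

theorem clutching_top (s : I) :
    clutching (s, 1) = complexToQuaternion (Complex.exp (sideLog (centered s))) := by
  rw [clutching_of_collapseHeight_eq_zero (by simp [collapseHeight, centered_one]), exp_sideLog]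
  simp only [centered_one, Complex.mk_eq_add_mul_I, Complex.ofReal_one, one_mul]

variable {ι : Type*} [Fintype ι] [DecidableEq ι] (R : ℍ[ℝ] →ₐ[ℝ] Matrix ι ι ℂ)

/-- The eigenprojections of the imaginary units in a representation `R` of the quaternions, pulled
back to the square. -/
def collapseProjection (p : I × I) : Matrix ι ι ℂ :=
  complexEigenprojection (R (unitIm (collapse ![p.1, p.2])))

theorem collapseProjection_zero :
    collapseProjection R 0 = complexEigenprojection (R (complexToQuaternion Complex.I)) := by
  rw [collapseProjection, collapse_boundary _ ⟨0, Or.inl rfl⟩, unitIm_northPole]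

/-- The clutching function of the bundle of the ranges of `collapseProjection R`. -/
def clutchingUnit (p : I × I) : (Matrix ι ι ℂ)ˣ :=
  Units.map (R : ℍ[ℝ] →* Matrix ι ι ℂ) (Units.mk0 (clutching p) (clutching_ne_zero p))

theorem clutchingUnit_of_side {p : I × I} (h : centered p.1 ^ 2 = 1 ∨ centered p.2 = -1) :
    clutchingUnit R p = 1 :=
  Units.ext ((congrArg R (clutching_of_side h)).trans (map_one R))

theorem isTrivialization_clutchingUnit :
    IsTrivialization (collapseProjection R) (clutchingUnit R) where
  continuous := by
    have hR : Continuous R := R.toLinearMap.continuous_of_finiteDimensional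
    exact Units.isOpenEmbedding_val.isEmbedding.continuous_iff.2 (hR.comp continuous_clutching)
  semiconjBy p := by
    rw [collapseProjection_zero]
    exact semiconjBy_complexEigenprojection ((semiconjBy_clutching p).map R)
  bottom s := clutchingUnit_of_side R (Or.inr centered_zero)
  left t := clutchingUnit_of_side R (Or.inl (by simp [centered_zero]))
  right t := clutchingUnit_of_side R (Or.inl (by simp [centered_one]))

theorem hasWinding_collapseProjection :
    HasWinding (collapseProjection R) ((sideLog 1 - sideLog (-1)) *
      (complexEigenprojection (R (complexToQuaternion Complex.I))).trace) := by
  refine ⟨clutchingUnit R, isTrivialization_clutchingUnit R,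
    fun s => sideLog (centered s) *
      (complexEigenprojection (R (complexToQuaternion Complex.I))).trace,
    (continuous_sideLog.comp continuous_centered).mul continuous_const, fun s => ?_, ?_⟩
  · rw [collapseProjection_zero]
    refine (rangeDet_complexEigenprojection_exp (R.comp complexToQuaternion) _).symm.trans ?_
    exact congrArg (fun x => rangeDet _ (R x)) (clutching_top s).symm
  · simp only [centered_one, centered_zero, sub_mul]

end Clutching

/-! ### The linear quaternionic sphere -/

section QuatSpace

/-- The Euclidean space `ℍ^{n+1}`. -/
abbrev QuatSpace (n : ℕ) : Type := PiLp 2 fun _ : Fin (n + 1) => ℍ[ℝ]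

variable {n : ℕ}

theorem quaternion_inner_mul_left (p v w : ℍ[ℝ]) :
    inner ℝ (p * v) w = inner ℝ v (star p * w) := by
  rw [Quaternion.inner_def, Quaternion.inner_def, star_mul, star_star]
  simp only [Quaternion.re_mul, Quaternion.imI_mul, Quaternion.imJ_mul, Quaternion.imK_mul,
    Quaternion.re_star, Quaternion.imI_star, Quaternion.imJ_star, Quaternion.imK_star]
  ring

theorem inner_smul_left_quatSpace (p : ℍ[ℝ]) (v w : QuatSpace n) :
    inner ℝ (p • v) w = inner ℝ v (star p • w) := by
  simp only [PiLp.inner_apply, PiLp.smul_apply, smul_eq_mul, quaternion_inner_mul_left]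

/-- Left multiplication by quaternions on `ℍ^{n+1}`. -/
def leftMul (n : ℕ) : ℍ[ℝ] →ₐ[ℝ] Module.End ℝ (QuatSpace n) := Algebra.lsmul ℝ ℝ (QuatSpace n)

theorem leftMul_unitIm_mul_self (z : S2) :
    leftMul n (unitIm z) * leftMul n (unitIm z) = -1 := by
  rw [← map_mul, unitIm_mul_self, map_neg, map_one]

theorem inner_leftMul_unitIm (z : S2) (v w : QuatSpace n) :
    inner ℝ (leftMul n (unitIm z) v) w = -inner ℝ v (leftMul n (unitIm z) w) := by
  refine (inner_smul_left_quatSpace _ v w).trans ?_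
  rw [star_unitIm, neg_smul, inner_neg_right]
  rfl

/-- The real unit of the first factor of `ℍ^{n+1}`. -/
def realUnit (n : ℕ) : QuatSpace n := PiLp.single 2 0 1

theorem norm_realUnit : ‖realUnit n‖ = 1 := by
  rw [realUnit, PiLp.norm_single, norm_one]

theorem realUnit_zero : realUnit n 0 = 1 := by simp [realUnit]

theorem realUnit_succ (i : Fin n) : realUnit n i.succ = 0 := by simp [realUnit]

theorem inner_realUnit (w : QuatSpace n) : inner ℝ (realUnit n) w = (w 0).re := by
  simp [PiLp.inner_apply, Fin.sum_univ_succ, realUnit_zero, realUnit_succ, Quaternion.inner_def]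

/-- The orthogonal projection of `ℍ^{n+1}` to `Im ℍ ⊕ ℍⁿ`. -/
def imProjection (n : ℕ) : QuatSpace n →ₗ[ℝ] ImH n where
  toFun w := ⟨((w 0).im, fun i => w i.succ), Quaternion.re_im _⟩
  map_add' v w := by ext <;> simp
  map_smul' c w := by ext <;> simp

theorem coe_imProjection {w : QuatSpace n} (hw : inner ℝ (realUnit n) w = 0) :
    (imProjection n w : ℍ[ℝ] × (Fin n → ℍ[ℝ])) = (w 0, fun i => w i.succ) := by
  rw [inner_realUnit] at hw
  have him : (w 0).im = w 0 := by simpa [hw] using Quaternion.re_add_im (w 0)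
  exact Prod.ext him rfl

theorem surjective_imProjection : Function.Surjective (imProjection n) := by
  intro w
  refine ⟨WithLp.toLp 2 (Fin.cons w.1.1 w.1.2), Subtype.ext ?_⟩
  exact coe_imProjection ((inner_realUnit _).trans w.2)

theorem ker_imProjection : LinearMap.ker (imProjection n) = ℝ ∙ realUnit n := by
  ext w
  rw [LinearMap.mem_ker, Submodule.mem_span_singleton]
  constructor
  · intro h
    have hfst : (w 0).im = 0 := congrArg (fun v : ImH n => v.1.1) h
    have hsnd (i : Fin n) : w i.succ = 0 := congrArg (fun v : ImH n => v.1.2 i) h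
    have hre : ((w 0).re : ℍ[ℝ]) = w 0 := by simpa [hfst] using Quaternion.re_add_im (w 0)
    refine ⟨(w 0).re, PiLp.ext (Fin.cases ?_ fun i => ?_)⟩
    · rw [PiLp.smul_apply, realUnit_zero, ← Algebra.algebraMap_eq_smul_one]
      exact hre
    · rw [PiLp.smul_apply, realUnit_succ, smul_zero, hsnd]
  · rintro ⟨c, rfl⟩
    refine Subtype.ext (Prod.ext ?_ (funext fun i => ?_))
    · simp [imProjection, realUnit_zero]
    · simp [imProjection, realUnit_succ]

theorem linearForm_imProjection (z : S2) (w : QuatSpace n) :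
    linearForm n z (imProjection n w) = inner ℝ (leftMul n (unitIm z) (realUnit n)) w := by
  simp [linearForm, leftMul, imProjection, PiLp.inner_apply, Fin.sum_univ_succ, realUnit_zero,
    realUnit_succ, unitIm_eq_quat, Quaternion.inner_def]
  ring

end QuatSpace

section Framing

variable {V : Type*} [NormedAddCommGroup V] [NormedSpace ℝ V] {n : ℕ}

/-- The splitting of `ℍ^{n+1}` as the sum of `V` and the line of the real unit, given by a framing
of `V` by `Im ℍ ⊕ ℍⁿ`. -/
def framingStabilization (τ : V ≃ₗ[ℝ] ImH n) : Stabilization V (QuatSpace n) where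
  e := realUnit n
  pr := LinearMap.toContinuousLinearMap (τ.symm.toLinearMap ∘ₗ imProjection n)
  norm_e := norm_realUnit
  ker_pr := (LinearEquiv.ker_comp _ _).trans ker_imProjection
  surjective_pr := τ.symm.surjective.comp surjective_imProjection

theorem framing_pr (τ : V ≃ₗ[ℝ] ImH n) (w : QuatSpace n) :
    τ ((framingStabilization τ).pr w) = imProjection n w :=
  τ.apply_symm_apply _

/-- The framing `τ` carries the linear contact structure `(a, Ω)`, with a compatible complex
structure `j` on `ker a`, to the member of the linear quaternionic sphere at `z`. -/
def IsQuaternionicFraming (τ : V ≃ₗ[ℝ] ImH n) (z : S2) (a : V →L[ℝ] ℝ)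
    (Ω : V →L[ℝ] V →L[ℝ] ℝ) : Prop :=
  (∃ c : ℝ, 0 < c ∧ ∀ u, a u = c * linearForm n z (τ u)) ∧
    ∃ j : V → V, ∀ u, a u = 0 → (τ (j u)).1 = unitIm z • (τ u).1 ∧
      (∀ v, a v = 0 → Ω (j u) (j v) = Ω u v) ∧ (u ≠ 0 → 0 < Ω u (j u))

variable {τ : V ≃ₗ[ℝ] ImH n} {z : S2} {a : V →L[ℝ] ℝ} {c : ℝ}

theorem comp_framing_pr (ha : ∀ u, a u = c * linearForm n z (τ u)) :
    a.comp (framingStabilization τ).pr =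
      c • InnerProductSpace.toDual ℝ (QuatSpace n) (leftMul n (unitIm z) (realUnit n)) := by
  ext w
  rw [ContinuousLinearMap.comp_apply, ha, framing_pr, linearForm_imProjection]
  rfl

theorem norm_leftMul_unitIm (z : S2) (w : QuatSpace n) : ‖leftMul n (unitIm z) w‖ = ‖w‖ := by
  rw [@norm_eq_sqrt_real_inner _ _ _ w, norm_eq_sqrt_real_inner,
    inner_map_map_of_skew (inner_leftMul_unitIm z) (leftMul_unitIm_mul_self z)]

theorem comp_framing_pr_ne_zero (hc : c ≠ 0) (ha : ∀ u, a u = c * linearForm n z (τ u)) :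
    a.comp (framingStabilization τ).pr ≠ 0 := by
  rw [comp_framing_pr ha]
  refine smul_ne_zero hc (norm_ne_zero_iff.1 ?_)
  rw [LinearIsometryEquiv.norm_map, norm_leftMul_unitIm, norm_realUnit]
  exact one_ne_zero

theorem unitNormal_comp_framing_pr (hc : 0 < c) (ha : ∀ u, a u = c * linearForm n z (τ u)) :
    unitNormal (a.comp (framingStabilization τ).pr) = leftMul n (unitIm z) (realUnit n) := by
  rw [comp_framing_pr ha, unitNormal_smul hc, unitNormal, LinearIsometryEquiv.norm_map,
    norm_leftMul_unitIm, norm_realUnit, inv_one, one_smul, LinearIsometryEquiv.symm_apply_apply]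

theorem framing_pr_leftMul (hc : 0 < c) (ha : ∀ u, a u = c * linearForm n z (τ u)) {j : V → V}
    (hj : ∀ u, a u = 0 → (τ (j u)).1 = unitIm z • (τ u).1) {w : QuatSpace n}
    (he : inner ℝ (realUnit n) w = 0) (hw : a ((framingStabilization τ).pr w) = 0) :
    (framingStabilization τ).pr (leftMul n (unitIm z) w) = j ((framingStabilization τ).pr w) := by
  have he' : inner ℝ (realUnit n) (leftMul n (unitIm z) w) = 0 := by
    rw [ha, framing_pr, linearForm_imProjection, inner_leftMul_unitIm] at hw
    simpa [hc.ne'] using hw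
  apply τ.injective
  apply Subtype.ext
  rw [hj _ hw, framing_pr, framing_pr, coe_imProjection he, coe_imProjection he']
  rfl

open scoped Matrix.Norms.L2Operator MatrixOrder ComplexOrder in
theorem positiveProjection_hermitianMatrix_framing {ι : Type*} [Fintype ι] [DecidableEq ι]
    (b : OrthonormalBasis ι ℝ (QuatSpace n)) {Ω : V →L[ℝ] V →L[ℝ] ℝ}
    (hskew : ∀ u v, Ω u v = -Ω v u) (h : IsQuaternionicFraming τ z a Ω) :
    positiveProjection
        (hermitianMatrix b.toBasis ((framingStabilization τ).form a Ω).toBilinForm) =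
      complexEigenprojection (complexMatrix b.toBasis (leftMul n (unitIm z))) := by
  obtain ⟨⟨c, hc, ha⟩, j, hj⟩ := h
  have hL := inner_leftMul_unitIm (n := n) z
  have hLL := leftMul_unitIm_mul_self (n := n) z
  have hν := unitNormal_comp_framing_pr hc ha
  have ha0 := comp_framing_pr_ne_zero hc.ne' ha
  have hae := (framingStabilization τ).comp_pr_e a
  have hpr {w : QuatSpace n} (he : inner ℝ (realUnit n) w = 0) (hw) :=
    framing_pr_leftMul hc ha (fun u hu => (hj u hu).1) he hw
  have hswap (v w : QuatSpace n) := (framingStabilization τ).form_swap a hskew v w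
  refine positiveProjection_hermitianMatrix b.toBasis (transpose_toMatrix_of_skew b hL)
    (B := ((framingStabilization τ).form a Ω).toBilinForm) hswap hLL ?_ ?_
  · refine stabilizedForm_map_map norm_realUnit ha0 hae hL hLL hν fun u v hu hau hv hav => ?_
    simp only [ContinuousLinearMap.bilinearComp_apply, hpr hu hau, hpr hv hav]
    exact (hj _ hau).2.1 _ hav
  · refine fun w hw => stabilizedForm_pos norm_realUnit ha0 hae hL hLL hν
      (fun u hu hau hu0 => ?_) hw
    simp only [ContinuousLinearMap.bilinearComp_apply, hpr hu hau]
    exact (hj _ hau).2.2 fun h => hu0 ((framingStabilization τ).eq_zero_of_pr_eq_zero hu h)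

end Framing

/-! ### Families of contact structures that are quaternionic at a point -/

section QuaternionicAt

open ContactForm
open scoped Matrix.Norms.L2Operator MatrixOrder ComplexOrder

variable {m : ℕ} {M : Type*} [TopologicalSpace M] [ChartedSpace (Model m) M]
  [IsManifold (𝓡 (2 * m + 1)) ∞ M]

/-- The linear contact structures induced at `q` by a family of contact structures over `S²` form a
linear quaternionic sphere, in a suitable framing. The conditions of `IsQuaternionicFraming` are
invariant under rescaling of the form, so that it is enough to require them for one form. -/
def QuaternionicAt (ξ : S2 → ContactStructure m M) (q : M) : Prop :=
  ∃ (n : ℕ) (τ : Model m ≃ₗ[ℝ] ImH n), ∀ z, ∃ α : ContactForm m M, α.ker = ξ z ∧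
    IsQuaternionicFraming τ z (formAt α q) (dFormAt α q)

theorem ContactSphere.AlmostQuaternionic.exists_quaternionicAt {ξ₀ : ContactStructure m M}
    {S : ContactSphere ξ₀} (hS : S.AlmostQuaternionic) :
    ∃ q, QuaternionicAt (fun z => (S.toMap z).1) q := by
  obtain ⟨j, -, -, hcompatible, n, q, τ, hτ⟩ := hS
  refine ⟨q, n, τ, fun z => ?_⟩
  obtain ⟨α, hα⟩ := Quotient.exists_rep (S.toMap z).1
  obtain ⟨hform, hτj⟩ := hτ z α hα
  refine ⟨α, hα, hform, j z q, fun u hu => ?_⟩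
  obtain ⟨-, -, hmap, hpos⟩ := hcompatible z α hα q u hu
  exact ⟨hτj u hu,
    fun v hv => (dFormAt_apply α q _ _).trans ((hmap v hv).trans (dFormAt_apply α q u v).symm),
    fun hu0 => (hpos hu0).trans_eq (dFormAt_apply α q u _).symm⟩

theorem hasWinding_contactProjection {ι : Type*} [Fintype ι] [DecidableEq ι] {n : ℕ}
    (b : OrthonormalBasis ι ℝ (QuatSpace n)) {τ : Model m ≃ₗ[ℝ] ImH n} {q : M}
    {ξ : S2 → ContactStructure m M} (hξ : ∀ z, ∃ α : ContactForm m M, α.ker = ξ z ∧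
      IsQuaternionicFraming τ z (formAt α q) (dFormAt α q)) :
    ∃ d ≠ 0, HasWinding (fun s : I × I =>
      contactProjection b.toBasis (framingStabilization τ) q (ξ (collapse ![s.1, s.2]))) d := by
  have hprojection (z : S2) : contactProjection b.toBasis (framingStabilization τ) q (ξ z) =
      complexEigenprojection (complexMatrix b.toBasis (leftMul n (unitIm z))) := by
    obtain ⟨α, hα, hframing⟩ := hξ z
    rw [← hα, contactProjection_ker]
    exact positiveProjection_hermitianMatrix_framing b (dFormAt_swap α q) hframing
  have : Nonempty ι := b.toBasis.index_nonempty
  refine ⟨_, mul_ne_zero sideLog_one_sub_sideLog_neg_one_ne_zero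
    (trace_complexEigenprojection_ne_zero
      (trace_complexMatrix b.toBasis (leftMul n (complexToQuaternion Complex.I)))), ?_⟩
  simp only [hprojection]
  exact hasWinding_collapseProjection ((complexMatrix b.toBasis).comp (leftMul n))

end QuaternionicAt

end ContactSpheres

end

open scoped Matrix.Norms.L2Operator in
theorem mainTheorem4_general {m : ℕ} {M : Type*} [TopologicalSpace M]
    [ChartedSpace (ContactSpheres.Model m) M] [IsManifold (𝓡 (2 * m + 1)) ∞ M]
    {X : Type*} [TopologicalSpace X] (Ξ : C(X, ContactSpheres.ContactStructure m M))
    (f : C(ContactSpheres.S2, X)) {q : M}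
    (h : ContactSpheres.QuaternionicAt (fun z => Ξ (f z)) q) :
    ¬ IsOfFinOrder (ContactSpheres.sphereClass f) := by
  obtain ⟨n, τ, hξ⟩ := h
  obtain ⟨d, hd, hwinding⟩ := ContactSpheres.hasWinding_contactProjection
    (stdOrthonormalBasis ℝ (ContactSpheres.QuatSpace n)) hξ
  have hcontinuous := (ContactSpheres.continuous_contactProjection
    (stdOrthonormalBasis ℝ (ContactSpheres.QuatSpace n)).toBasis
    (ContactSpheres.framingStabilization τ) q).comp Ξ.continuous
  exact ContactSpheres.HasWinding.not_isOfFinOrder hcontinuous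
    (fun y => ContactSpheres.isIdempotentElem_contactProjection _ _ q (Ξ y)) hd hwinding

theorem mainTheorem4 {m : ℕ} {M : Type*} [TopologicalSpace M] [T2Space M]
    [SecondCountableTopology M] [ChartedSpace (ContactSpheres.Model m) M]
    [IsManifold (𝓡 (2 * m + 1)) ∞ M] (ξ₀ : ContactSpheres.ContactStructure m M)
    (S : ContactSpheres.ContactSphere ξ₀) (hS : S.AlmostQuaternionic) :
    ¬ IsOfFinOrder (ContactSpheres.sphereClass S.toMap) :=
  hS.exists_quaternionicAt.elim fun _ h =>
    mainTheorem4_general ⟨Subtype.val, continuous_subtype_val⟩ S.toMap h
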